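/- Let $\Sigma\subset\mathbb{R}^d$ be a compact embedded $k$-dimensional submanifold without boundary, $k\ge 2$, that is smooth (class $C^2$ is enough); $\Sigma$ need not be connected. Write $|pq|$ for Euclidean distance. The medial axis $M$ of $\Sigma$ is the closure of the set of points of $\mathbb{R}^d$ that have more than one nearest point on $\Sigma$, and the local feature size of $p$ is $\mathrm{lfs}(p)=\operatorname{dist}(p,M)$. Let $\epsilon<1/2$ and let $V$ be an $\epsilon$-sample of $\Sigma$, that is, a finite set $V\subset\Sigma$ such that for every $p\in\Sigma$ there is $w\in V$ with $|pw|\le\epsilon\,\mathrm{lfs}(p)$. A restricted Delaunay triangle is a triangle $\tau=\triangle vv'v''$ with vertices in $V$ for which there is a point $u\in\Sigma$ lying in the Voronoi cells (with respect to $V$) of $v$, $v'$ and $v''$, i.e. $|uv|=|uv'|=|uv''|=\min_{w\in V}|uw|$; every such $u$ is called a restricted Voronoi vertex dual to $\tau$. Then for every restricted Delaunay triangle $\tau$ and every point $x\in\tau$, there is a unique point $\tilde x$ of $\Sigma$ nearest to $x$, and $$|x\tilde x|\le\left(1-\sqrt{1-\left(\frac{\epsilon}{1-\epsilon}\right)^2}\right)\mathrm{lfs}(\tilde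 x),$$ $$|x\tilde x|\le\left(1-\epsilon-\sqrt{1-2\epsilon}\right)\mathrm{lfs}(u)\quad\text{for every restricted Voronoi vertex } u \text{ dual to } \tau.$$ Moreover, if $\epsilon\le 1/3$, then for every angle $\phi\in(0^\circ,60^\circ]$, $$\angle(N_\tau,N_{\tilde x}\Sigma)\le\max\left\{\eta\left(\frac{\epsilon}{1-\epsilon}\right)+\arcsin\left(\frac{\epsilon}{1-\epsilon}\cot\frac{\phi}{2}\right),\ 2\eta(\epsilon)+\arcsin\left(\frac{\epsilon}{1-\epsilon}\cot\left(45^\circ-\frac{\phi}{4}\right)\right)\right\},$$ where $\arcsin t$ is read as $90^\circ$ if $t>1$. Here $N_\tau$ is the flat of all points equidistant from the three vertices of $\tau$; $N_{\tilde x}\Sigma$ is the flat through $\tilde x$ orthogonal to the tangent space of $\Sigma$ at $\tilde x$; the angle between two flats $F,G$ with $\dim F\le\dim G$ is $\angle(F,G)=\angle(G,F)=\max_{\ell_F\subset F}\min_{\ell_G\subset G}\angle(\ell_F,\ell_G)\in[0^\circ,90^\circ]$ over lines $\ell_F,\ell_G$; and $$\eta(\delta)=\arccos\left(1-\frac{\delta^2}{2\sqrt{1-\delta^2}}\right)\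 \text{ if } d-k=1,\qquad \eta(\delta)=\arccos\sqrt{1-\frac{\delta^2}{\sqrt{1-\delta^2}}}\ \text{ if } d-k\ge 2.$$ -/

import Mathlib

namespace SurfApprox

noncomputable section

section Metric

variable {E : Type*} [MetricSpace E]

/-- `y` is a point of `S` nearest to `x`. -/
def IsNearestPoint (S : Set E) (x y : E) : Prop :=
  y ∈ S ∧ ∀ z ∈ S, dist x y ≤ dist x z

/-- The medial axis of `S`: the closure of the set of points that have more than one nearest point
on `S`. -/
def medialAxis (S : Set E) : Set E :=
  closure {w | ∃ a b, a ≠ b ∧ IsNearestPoint S w a ∧ IsNearestPoint S w b}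

/-- The local feature size at `p`: the distance from `p` to the medial axis. -/
def lfs (S : Set E) (p : E) : ℝ :=
  Metric.infDist p (medialAxis S)

/-- The finite set `V` is an `ε`-sample of `S`. -/
def IsEpsSample (S : Set E) (ε : ℝ) (V : Finset E) : Prop :=
  (V : Set E) ⊆ S ∧ ∀ p ∈ S, ∃ w ∈ V, dist p w ≤ ε * lfs S p

/-- The (closed) Voronoi cell of the site `v` in the Voronoi diagram of `V`. -/
def voronoiCell (V : Finset E) (v : E) : Set E :=
  {p | ∀ w ∈ V, dist p v ≤ dist p w}

/-- The Voronoi face dual to the simplex with vertex set `τ`: the common part of the Voronoi cells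
of the vertices of `τ`. -/
def voronoiFace (V τ : Finset E) : Set E :=
  {p | ∀ v ∈ τ, p ∈ voronoiCell V v}

/-- `u` is a restricted Voronoi vertex dual to the triangle with vertex set `τ`: a point of `S` on
the Voronoi face dual to `τ`. -/
def IsRestrictedVoronoiVertex (S : Set E) (V τ : Finset E) (u : E) : Prop :=
  u ∈ voronoiFace V τ ∩ S

end Metric

section Flats

variable {E : Type*} [NormedAddCommGroup E] [InnerProductSpace ℝ E]

/-- `τ` is the vertex set of a restricted Delaunay triangle of `V` on `S`: three affinely
independent points of `V` whose dual Voronoi face meets `S`. -/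
def IsRestrictedDelaunayTriangle (S : Set E) (V τ : Finset E) : Prop :=
  τ ⊆ V ∧ τ.card = 3 ∧ AffineIndependent ℝ (fun v : τ => (v : E)) ∧
    (voronoiFace V τ ∩ S).Nonempty

/-- The normal flat of the simplex with vertex set `τ`: all points that are equidistant from all
the vertices of `τ`. -/
def simplexNormal (τ : Finset E) : AffineSubspace ℝ E :=
  ⨅ v ∈ τ, ⨅ w ∈ τ, AffineSubspace.perpBisector v w

/-- The direction of the tangent space of `S` at `p`, spanned by the velocities of the curves in
`S` through `p`. -/
def tangentDir (S : Set E) (p : E) : Submodule ℝ E :=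
  Submodule.span ℝ {v | ∃ γ : ℝ → E, (∀ t, γ t ∈ S) ∧ γ 0 = p ∧ HasDerivAt γ v 0}

/-- The normal space of `S` at `p`: the flat through `p` that is the orthogonal complement of the
tangent space. -/
def normalSpace (S : Set E) (p : E) : AffineSubspace ℝ E :=
  AffineSubspace.mk' p (tangentDir S p)ᗮ

/-- The angle in `[0, π/2]` between two undirected lines with direction vectors `v` and `w`. -/
def lineAngle (v w : E) : ℝ :=
  min (InnerProductGeometry.angle v w) (Real.pi - InnerProductGeometry.angle v w)

/-- The maximum over the lines of `F` of the minimum over the lines of `G` of the angle between the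
two lines (lines enter through their nonzero direction vectors). -/
def maxMinAngle (F G : Submodule ℝ E) : ℝ :=
  ⨆ v : {v : E // v ∈ F ∧ v ≠ 0}, ⨅ w : {w : E // w ∈ G ∧ w ≠ 0}, lineAngle v.1 w.1

/-- The angle between two flats: the maximum is taken over the lines of the flat of lower
dimension. -/
def flatAngle (F G : AffineSubspace ℝ E) : ℝ :=
  if Module.finrank ℝ F.direction ≤ Module.finrank ℝ G.direction then
    maxMinAngle F.direction G.direction
  else
    maxMinAngle G.direction F.direction

end Flats

/-- `S` is an embedded `k`-dimensional submanifold of `ℝ^d` of class `C²`, without boundary: locally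
`S` is the zero set of a `C²` submersion to `ℝ^c`, where `k + c = d`. -/
def IsSubmanifold {d : ℕ} (k : ℕ) (S : Set (EuclideanSpace ℝ (Fin d))) : Prop :=
  ∀ p ∈ S, ∃ (c : ℕ) (U : Set (EuclideanSpace ℝ (Fin d)))
    (f : EuclideanSpace ℝ (Fin d) → EuclideanSpace ℝ (Fin c)),
    k + c = d ∧ IsOpen U ∧ p ∈ U ∧ ContDiffOn ℝ 2 f U ∧
      (∀ q ∈ U, Function.Surjective (fderiv ℝ f q)) ∧ S ∩ U = {q ∈ U | f q = 0}

/-- The normal variation bound in codimension one. -/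
def eta₁ (δ : ℝ) : ℝ :=
  Real.arccos (1 - δ ^ 2 / (2 * √(1 - δ ^ 2)))

/-- The normal variation bound in codimension two and higher. -/
def eta₂ (δ : ℝ) : ℝ :=
  Real.arccos √(1 - δ ^ 2 / √(1 - δ ^ 2))

/-- The normal variation bound for `k`-manifolds in `ℝ^d`. -/
def eta (d k : ℕ) (δ : ℝ) : ℝ :=
  if d = k + 1 then eta₁ δ else eta₂ δ

/-- The bound on the normal error with parameter `φ`. -/
def normalErrorBound (d k : ℕ) (ε φ : ℝ) : ℝ :=
  max (eta d k (ε / (1 - ε)) + Real.arcsin (ε / (1 - ε) * Real.cot (φ / 2)))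
    (2 * eta d k ε + Real.arcsin (ε / (1 - ε) * Real.cot (Real.pi / 4 - φ / 4)))

end

end SurfApprox

namespace SurfApprox

open Filter Topology

/-! ### Growing empty balls off the medial axis -/

section NearestPoint

/-! Everything rests on empty balls. Off `S` and the medial axis the nearest point is unique, so the
distance to `S` grows at unit rate when moving away from it. Hence an open ball that misses `S` and
touches it at `p` stays empty while its centre is pushed outward, until the centre meets the medial
axis (`empty_ball_extension`). A C² submanifold has a small empty ball in every normal direction,
which starts the growth (`IsSubmanifold.empty_ball`).

Distances: the vertices of τ lie on a sphere of radius R ≤ ε lfs(u) about u and outside every empty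
ball. The difference of the powers of a point with respect to two spheres is affine, so a comparison
of powers at the vertices holds on all of τ (`power_le_of_mem_convexHull`). The ball of radius
lfs(x̃) tangent at x̃ gives the first bound. The tangent ball whose centre is at distance lfs(u)
from u gives |xx̃| ≤ R²/(2 lfs(u)), which is stronger than the second bound, and also |x̃u| ≤ R.

Normal variation: scale so that one point is 0 with feature size 1. A unit normal n at q carries two
opposite empty balls with centres on the unit sphere. Since `S` covers a disc of its tangent space
at 0, such a ball can miss `S` only if its centre has a large component normal to `S` at 0; the two
centres together bound the normal part of n from below. The covering requires that no normal near 0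
be tangent at 0, which follows from the same estimate applied at the nearest violation
(`eq_zero_of_mem_tangent`).

Normal error: empty balls at a vertex bound the inner products of a surface normal with the two
edges, hence its component in the plane of τ; the loss is governed by the angle at that vertex
(`angleLE_simplexNormal`). Some vertex v is within R of x̃. If its angle is at least φ, compare the
normals at x̃, at v and of τ. Otherwise another vertex has angle at least (180° − φ)/2, and the
comparison goes from x̃ through u to that vertex. -/

theorem exists_isNearestPoint {E : Type*} [MetricSpace E] {S : Set E} (hS : IsCompact S)
    (hne : S.Nonempty) (x : E) : ∃ y, IsNearestPoint S x y := by
  obtain ⟨y, hy, h⟩ := hS.exists_infDist_eq_dist hne x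
  exact ⟨y, hy, fun z hz => h ▸ Metric.infDist_le_dist_of_mem hz⟩

theorem IsNearestPoint.infDist_eq {E : Type*} [MetricSpace E] {S : Set E} {x y : E}
    (h : IsNearestPoint S x y) : Metric.infDist x S = dist x y :=
  le_antisymm (Metric.infDist_le_dist_of_mem h.1)
    ((Metric.le_infDist ⟨y, h.1⟩).2 fun {z} hz => h.2 z hz)

theorem IsNearestPoint.eq_of_notMem_medialAxis {E : Type*} [MetricSpace E] {S : Set E}
    {x a b : E} (hx : x ∉ medialAxis S) (ha : IsNearestPoint S x a) (hb : IsNearestPoint S x b) :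
    a = b := by
  by_contra hab
  exact hx (subset_closure ⟨a, b, hab, ha, hb⟩)

theorem lfs_nonneg {E : Type*} [MetricSpace E] (S : Set E) (p : E) : 0 ≤ lfs S p :=
  Metric.infDist_nonneg

theorem lfs_le_lfs_add_dist {E : Type*} [MetricSpace E] (S : Set E) (p q : E) :
    lfs S p ≤ lfs S q + dist p q :=
  Metric.infDist_le_infDist_add_dist

theorem notMem_medialAxis_of_dist_lt_lfs {E : Type*} [MetricSpace E] {S : Set E} {p x : E}
    (h : dist p x < lfs S p) : x ∉ medialAxis S := fun hx =>
  absurd (Metric.infDist_le_dist_of_mem hx) (not_le.2 h)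

variable {E : Type*} [NormedAddCommGroup E] [InnerProductSpace ℝ E]

/-- At a point with a unique nearest point on `S`, the distance to `S` has slope one. -/
theorem exists_infDist_slope {S : Set E} (hS : IsCompact S) {y q : E} (hyS : y ∉ S)
    (hy : y ∉ medialAxis S) (hq : IsNearestPoint S y q) {a : ℝ} (ha : a < 1)
    {η : ℝ} (hη : 0 < η) :
    ∃ z, z ≠ y ∧ dist z y < η ∧ Metric.infDist y S + a * dist z y ≤ Metric.infDist z S := by
  have hyq : y ≠ q := fun h => hyS (h ▸ hq.1)
  have hd : 0 < ‖y - q‖ := norm_pos_iff.2 (sub_ne_zero.2 hyq)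
  set e : E := ‖y - q‖⁻¹ • (y - q) with he
  have hen : ‖e‖ = 1 := by rw [he, norm_smul, norm_inv, norm_norm, inv_mul_cancel₀ hd.ne']
  have hfy : Metric.infDist y S = ‖y - q‖ := by rw [hq.infDist_eq, dist_eq_norm]
  -- Moving from `y` along `e` gains slope `a` against every point outside `K`. Points of `K` gain
  -- less, but by uniqueness of `q` they are farther than `q` by a fixed gap `g`, which a short move
  -- cannot use up.
  set K : Set E := S ∩ {w | inner ℝ e (y - w) ≤ a * ‖y - w‖} with hK
  have hKc : IsCompact K := hS.inter_right (isClosed_le (by fun_prop) (by fun_prop))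
  have hqK : q ∉ K := by
    rintro ⟨-, h⟩
    have : inner ℝ e (y - q) = ‖y - q‖ := by
      rw [he, real_inner_smul_left, real_inner_self_eq_norm_sq]; field_simp
    simp only [Set.mem_ofPred_eq, this] at h
    nlinarith
  obtain ⟨g, hg, hgK⟩ : ∃ g > 0, ∀ w ∈ K, ‖y - q‖ + g ≤ ‖y - w‖ := by
    rcases K.eq_empty_or_nonempty with h | h
    · exact ⟨1, one_pos, by simp [h]⟩
    obtain ⟨w, hw, hmin⟩ := hKc.exists_isMinOn h
      (f := fun w => ‖y - w‖) (by fun_prop)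
    refine ⟨‖y - w‖ - ‖y - q‖, ?_, fun v hv => by have := hmin hv; simp at this; linarith⟩
    rw [gt_iff_lt, sub_pos]
    refine lt_of_le_of_ne (by simpa [dist_eq_norm] using hq.2 w hw.1) fun h => ?_
    refine hqK ?_
    have : IsNearestPoint S y w := ⟨hw.1, fun z hz => by
      rw [dist_eq_norm, ← h, ← dist_eq_norm]; exact hq.2 z hz⟩
    rwa [hq.eq_of_notMem_medialAxis hy this]
  set t := min (η / 2) (g / 2) with ht
  have ht0 : 0 < t := lt_min (by positivity) (by positivity)
  have hzy : dist (y + t • e) y = t := by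
    rw [dist_eq_norm, add_sub_cancel_left, norm_smul, hen, mul_one, Real.norm_of_nonneg ht0.le]
  refine ⟨y + t • e, fun h => ?_, ?_, ?_⟩
  · rw [h, dist_self] at hzy; exact ht0.ne hzy
  · rw [hzy]; exact (min_le_left _ _).trans_lt (by linarith)
  · rw [hzy, hfy]
    refine (Metric.le_infDist ⟨q, hq.1⟩).2 fun {w} hw => ?_
    rw [dist_eq_norm]
    by_cases hwK : w ∈ K
    · have h1 := hgK w hwK
      have h2 : ‖y - w‖ ≤ ‖y + t • e - w‖ + t := by
        have := norm_sub_le (y + t • e - w) (t • e)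
        rw [norm_smul, hen, mul_one, Real.norm_of_nonneg ht0.le] at this
        rwa [show y + t • e - w - t • e = y - w by abel] at this
      have h3 : t ≤ g / 2 := min_le_right _ _
      nlinarith
    · have h1 : a * ‖y - w‖ < inner ℝ e (y - w) := by
        by_contra h; exact hwK ⟨hw, not_lt.1 h⟩
      have h2 : ‖y - q‖ ≤ ‖y - w‖ := by simpa [dist_eq_norm] using hq.2 w hw
      have h3 : inner ℝ (y - w) (y + t • e - w) ≤ ‖y - w‖ * ‖y + t • e - w‖ :=
        real_inner_le_norm _ _
      have h4 : inner ℝ (y - w) (y + t • e - w) = ‖y - w‖ ^ 2 + t * inner ℝ e (y - w) := by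
        rw [show y + t • e - w = (y - w) + t • e by abel, inner_add_right,
          real_inner_self_eq_norm_sq, real_inner_smul_right, real_inner_comm]
      have h5 : 0 < ‖y - w‖ := hd.trans_le h2
      have h6 : ‖y - w‖ * (‖y - w‖ + a * t) ≤ ‖y - w‖ * ‖y + t • e - w‖ := by
        nlinarith
      have h7 := le_of_mul_le_mul_left h6 h5
      linarith

/-- On a closed ball without medial axis points, the distance to `S` grows by the full radius. -/
theorem exists_infDist_add_le [ProperSpace E] {S : Set E} (hS : IsCompact S) (hne : S.Nonempty)
    {c : E} {ρ : ℝ} (hρ : 0 ≤ ρ) (hc : c ∉ S)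
    (hM : ∀ y ∈ Metric.closedBall c ρ, y ∉ medialAxis S) :
    ∃ y ∈ Metric.closedBall c ρ, Metric.infDist c S + ρ ≤ Metric.infDist y S := by
  have hcont : Continuous fun y => Metric.infDist y S := Metric.continuous_infDist_pt S
  have hc0 : 0 < Metric.infDist c S :=
    (hS.isClosed.notMem_iff_infDist_pos hne).1 hc
  obtain ⟨y, hy, hmax⟩ := (isCompact_closedBall c ρ).exists_isMaxOn
    ⟨c, Metric.mem_closedBall_self hρ⟩ hcont.continuousOn
  refine ⟨y, hy, ?_⟩
  suffices h : ∀ a : ℝ, 0 ≤ a → a < 1 → Metric.infDist c S + a * ρ ≤ Metric.infDist y S by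
    refine le_of_tendsto (f := fun a : ℝ => Metric.infDist c S + a * ρ) (x := 𝓝[<] 1) ?_ ?_
    · have : ContinuousAt (fun a : ℝ => Metric.infDist c S + a * ρ) 1 := by fun_prop
      simpa using this.tendsto.mono_left nhdsWithin_le_nhds
    · filter_upwards [Ioo_mem_nhdsLT (show (0 : ℝ) < 1 by norm_num)] with a ha
      exact h a ha.1.le ha.2
  intro a ha0 ha1
  -- A maximizer on `A` interior to the ball could be moved on with slope `a`, staying in `A` by the
  -- triangle inequality; so it lies on the sphere.
  set A : Set E := Metric.closedBall c ρ ∩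
    {z | Metric.infDist c S + a * dist z c ≤ Metric.infDist z S} with hA
  have hAc : IsCompact A :=
    (isCompact_closedBall c ρ).inter_right (isClosed_le (by fun_prop) hcont)
  obtain ⟨z, hz, hzmax⟩ := hAc.exists_isMaxOn
    ⟨c, Metric.mem_closedBall_self hρ, by simp⟩ hcont.continuousOn
  have hz2 : Metric.infDist c S + a * dist z c ≤ Metric.infDist z S := hz.2
  rcases (Metric.mem_closedBall.1 hz.1).eq_or_lt with h | h
  · rw [← h]
    exact hz2.trans (hmax hz.1)
  exfalso
  have hzS : z ∉ S := by
    rw [hS.isClosed.notMem_iff_infDist_pos hne]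
    have : 0 ≤ a * dist z c := by positivity
    linarith
  obtain ⟨q, hq⟩ := exists_isNearestPoint hS hne z
  -- Slope `0` would not increase the distance strictly, so slope `1 / 2` is used when `a = 0`.
  rcases ha0.eq_or_lt with rfl | ha0'
  · obtain ⟨v, hvz, hv1, hv2⟩ := exists_infDist_slope hS hzS (hM z hz.1) hq
      (a := 1 / 2) (by norm_num) (sub_pos.2 h)
    have hvA : v ∈ A := by
      refine ⟨Metric.mem_closedBall.2 ?_, ?_⟩
      · linarith [dist_triangle v z c]
      · have : 0 ≤ dist v z := dist_nonneg
        simp only [Set.mem_ofPred_eq]; linarith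
    have h1 : Metric.infDist v S ≤ Metric.infDist z S := hzmax hvA
    have : 0 < dist v z := dist_pos.2 hvz
    linarith
  · obtain ⟨v, hvz, hv1, hv2⟩ := exists_infDist_slope hS hzS (hM z hz.1) hq
      ha1 (sub_pos.2 h)
    have hvA : v ∈ A := by
      refine ⟨Metric.mem_closedBall.2 ?_, ?_⟩
      · linarith [dist_triangle v z c]
      · simp only [Set.mem_ofPred_eq]
        nlinarith [dist_triangle v z c]
    have h1 : Metric.infDist v S ≤ Metric.infDist z S := hzmax hvA
    have : 0 < dist v z := dist_pos.2 hvz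
    nlinarith

/-- An empty ball touching `S` at `p` can be enlarged, keeping its tangent point, as long as its
center does not reach the medial axis. -/
theorem empty_ball_extension [ProperSpace E] {S : Set E} (hS : IsCompact S) {p n : E} (hp : p ∈ S)
    (hn : ‖n‖ = 1) {r₀ r : ℝ} (hr₀ : 0 < r₀) (hr : r₀ ≤ r)
    (h₀ : ∀ w ∈ S, r₀ ≤ dist (p + r₀ • n) w)
    (hM : ∀ s, r₀ ≤ s → s < r → p + s • n ∉ medialAxis S) :
    ∀ w ∈ S, r ≤ dist (p + r • n) w := by
  have hne : S.Nonempty := ⟨p, hp⟩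
  set G : Set ℝ := Set.Icc r₀ r ∩ {s | s ≤ Metric.infDist (p + s • n) S} with hG
  have hGc : IsCompact G := isCompact_Icc.inter_right
    (isClosed_le continuous_id ((Metric.continuous_infDist_pt S).comp (by fun_prop)))
  obtain ⟨s, ⟨hs1, hs2⟩, hsmax⟩ := hGc.exists_isGreatest
    ⟨r₀, ⟨le_refl _, hr⟩, (Metric.le_infDist hne).2 fun {w} hw => h₀ w hw⟩
  simp only [Set.mem_ofPred_eq] at hs2
  rcases hs1.2.eq_or_lt with rfl | hlt
  · exact fun w hw => hs2.trans (Metric.infDist_le_dist_of_mem hw)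
  exfalso
  have hs0 : 0 < s := hr₀.trans_le hs1.1
  set c := p + s • n with hc
  have hcp : dist c p = s := by
    rw [hc, dist_eq_norm, add_sub_cancel_left, norm_smul, hn, mul_one, Real.norm_of_nonneg hs0.le]
  have hcM : c ∈ (medialAxis S)ᶜ := hM s hs1.1 hlt
  obtain ⟨δ, hδ, hball⟩ := Metric.isOpen_iff.1 (isClosed_closure (s :=
    {w | ∃ a b, a ≠ b ∧ IsNearestPoint S w a ∧ IsNearestPoint S w b})).isOpen_compl c hcM
  set ρ := min (δ / 2) (r - s) with hρ
  have hρ0 : 0 < ρ := lt_min (by positivity) (sub_pos.2 hlt)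
  have hcS : c ∉ S := by
    rw [hS.isClosed.notMem_iff_infDist_pos hne]; exact hs0.trans_le hs2
  obtain ⟨y, hy, hfy⟩ := exists_infDist_add_le hS hne hρ0.le hcS fun y hy => hball <| by
    have := min_le_left (δ / 2) (r - s)
    rw [Metric.mem_closedBall] at hy
    rw [Metric.mem_ball]; linarith
  have hfc : s + ρ ≤ Metric.infDist y S := by linarith
  -- `y` is within `ρ` of `c` and at least `s + ρ` from `p`, while `c` is at distance `s` from `p`:
  -- equality in the triangle inequality puts `y` on the ray from `p` through `c`.
  have hyp : s + ρ ≤ ‖y - p‖ := by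
    rw [← dist_eq_norm]; exact hfc.trans (Metric.infDist_le_dist_of_mem hp)
  have hyc : ‖y - c‖ ≤ ρ := by rw [← dist_eq_norm]; exact hy
  have hyeq : y = p + (s + ρ) • n := by
    have h1 : ‖y - p‖ ^ 2 = ‖y - c‖ ^ 2 + 2 * (s * inner ℝ (y - c) n) + s ^ 2 := by
      rw [show y - p = (y - c) + s • n by rw [hc]; abel, norm_add_sq_real, real_inner_smul_right,
        norm_smul, hn, mul_one, Real.norm_of_nonneg hs0.le]
    have h2 : ρ ≤ inner ℝ (y - c) n := by
      have : (s + ρ) ^ 2 ≤ ‖y - p‖ ^ 2 := by gcongr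
      have h5 : ‖y - c‖ ^ 2 ≤ ρ ^ 2 := by gcongr
      have : s * ρ ≤ s * inner ℝ (y - c) n := by nlinarith
      exact le_of_mul_le_mul_left this hs0
    have h3 : ‖y - c - ρ • n‖ ^ 2 ≤ 0 := by
      rw [norm_sub_sq_real, real_inner_smul_right, norm_smul, hn, mul_one, Real.norm_of_nonneg hρ0.le]
      have : ‖y - c‖ ^ 2 ≤ ρ ^ 2 := by gcongr
      nlinarith
    have h4 : y - c - ρ • n = 0 := by
      rw [← norm_eq_zero]; nlinarith [norm_nonneg (y - c - ρ • n)]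
    rw [add_smul, ← add_assoc, ← hc, ← sub_eq_zero, ← h4]; abel
  have : s + ρ ≤ s := hsmax ⟨⟨by linarith [hs1.1], by linarith [min_le_right (δ / 2) (r - s)]⟩, by
    rw [hyeq] at hfc; exact hfc⟩
  linarith

end NearestPoint

end SurfApprox

namespace SurfApprox

open Filter Topology

/-! ### First-order conditions at minima on `S` -/

section Tangent

variable {E : Type*} [NormedAddCommGroup E] [InnerProductSpace ℝ E]

/-- The gradient at a local minimum of `g` on `S` is orthogonal to the tangent space. -/
theorem apply_eq_zero_of_isLocalMinOn {S : Set E} {p : E} {g : E → ℝ} {g' : E →L[ℝ] ℝ}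
    (hg : HasFDerivAt g g' p) (hmin : IsLocalMinOn g S p) {v : E} (hv : v ∈ tangentDir S p) :
    g' v = 0 := by
  suffices h : tangentDir S p ≤ g'.toLinearMap.ker from h hv
  refine Submodule.span_le.2 ?_
  rintro v ⟨γ, hγS, rfl, hγ⟩
  have h1 : HasDerivAt (g ∘ γ) (g' v) 0 := hg.comp_hasDerivAt 0 hγ
  have h2 : IsLocalMin (g ∘ γ) 0 := by
    have ht : Tendsto γ (𝓝 0) (𝓝[S] (γ 0)) :=
      tendsto_nhdsWithin_iff.2 ⟨hγ.continuousAt, Eventually.of_forall hγS⟩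
    exact ht.eventually hmin
  exact h2.hasDerivAt_eq_zero h1

/-- Differentiate the squared distance along curves in `S`. The case `T = ⊤` treats nearest points;
`T` a tangent space is needed to show that `S` covers a disc of it. -/
theorem sub_starProjection_mem_normal {S : Set E} {p x : E} (T : Submodule ℝ E)
    [T.HasOrthogonalProjection] (hx : x ∈ T)
    (hmin : IsLocalMinOn (fun w => ‖x - T.starProjection w‖) S p) :
    x - T.starProjection p ∈ (tangentDir S p)ᗮ := by
  have hg : HasFDerivAt (fun w => ‖x - T.starProjection w‖ ^ 2)
      (2 • (innerSL ℝ (x - T.starProjection p)).comp (0 - T.starProjection)) p :=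
    HasFDerivAt.norm_sq ((hasFDerivAt_const x p).sub T.starProjection.hasFDerivAt)
  have hmin' : IsLocalMinOn (fun w => ‖x - T.starProjection w‖ ^ 2) S p := by
    filter_upwards [hmin] with w hw
    exact pow_le_pow_left₀ (norm_nonneg _) hw 2
  rw [Submodule.mem_orthogonal]
  intro v hv
  have h := apply_eq_zero_of_isLocalMinOn hg hmin' hv
  have h2 : inner ℝ (x - T.starProjection p) (T.starProjection v) = 0 := by
    have h' := sub_eq_zero.1 (show inner ℝ (T.starProjection p) (T.starProjection v) -
      inner ℝ x (T.starProjection v) = 0 by simpa using h)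
    rw [inner_sub_left, h', sub_self]
  rw [real_inner_comm]
  have hm : x - T.starProjection p ∈ T := T.sub_mem hx (Submodule.starProjection_apply_mem _ _)
  rw [← h2, ← Submodule.inner_starProjection_left_eq_right,
    Submodule.starProjection_eq_self_iff.2 hm]

theorem sub_mem_normal_of_isNearestPoint [CompleteSpace E] {S : Set E} {p x : E}
    (h : IsNearestPoint S x p) : x - p ∈ (tangentDir S p)ᗮ := by
  have := sub_starProjection_mem_normal (S := S) (p := p) (x := x) ⊤ trivial (by
    filter_upwards [self_mem_nhdsWithin] with w hw
    simpa [dist_eq_norm, Submodule.starProjection_top] using h.2 w hw)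
  simpa [Submodule.starProjection_top] using this

end Tangent

/-! ### Tangent spaces and empty balls of C² submanifolds -/

section Submanifold

variable {d k : ℕ} {S : Set (EuclideanSpace ℝ (Fin d))}

theorem tangentDir_eq_ker {c : ℕ} {p : EuclideanSpace ℝ (Fin d)}
    {U : Set (EuclideanSpace ℝ (Fin d))}
    {f : EuclideanSpace ℝ (Fin d) → EuclideanSpace ℝ (Fin c)}
    (hp : p ∈ S) (hU : IsOpen U) (hpU : p ∈ U) (hf : ContDiffOn ℝ 2 f U)
    (hsurj : Function.Surjective (fderiv ℝ f p)) (hSU : S ∩ U = {q ∈ U | f q = 0}) :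
    tangentDir S p = (fderiv ℝ f p).toLinearMap.ker := by
  have hfp : ContDiffAt ℝ 2 f p := hf.contDiffAt (hU.mem_nhds hpU)
  have hmem : ∀ q ∈ U, (q ∈ S ↔ f q = 0) := fun q hq => by
    have := Set.ext_iff.1 hSU q
    simp only [Set.mem_inter_iff, hq, and_true] at this
    rw [this]; exact ⟨fun h => h.2, fun h => ⟨hq, h⟩⟩
  have hf0 : f p = 0 := (hmem p hpU).1 hp
  refine le_antisymm (Submodule.span_le.2 ?_) fun v hv => Submodule.subset_span ?_
  · rintro v ⟨γ, hγS, rfl, hγ⟩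
    have h1 : HasDerivAt (f ∘ γ) (fderiv ℝ f (γ 0) v) 0 :=
      (hfp.differentiableAt (by norm_num)).hasFDerivAt.comp_hasDerivAt 0 hγ
    have h2 : (f ∘ γ) =ᶠ[𝓝 0] fun _ => 0 := by
      filter_upwards [hγ.continuousAt.eventually (hU.mem_nhds hpU)] with t ht
      exact (hmem _ ht).1 (hγS t)
    exact (h1.congr_of_eventuallyEq h2.symm).unique (hasDerivAt_const _ _)
  · have hs : HasStrictFDerivAt f (fderiv ℝ f p) p := hfp.hasStrictFDerivAt (by norm_num)
    have hr : (fderiv ℝ f p).range = ⊤ := LinearMap.range_eq_top.2 hsurj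
    set ψ : ℝ → EuclideanSpace ℝ (Fin d) :=
      fun t => hs.implicitFunction f (fderiv ℝ f p) hr (f p) (t • ⟨v, hv⟩) with hψ
    have hψ0 : ψ 0 = p := by
      simp only [hψ, zero_smul]
      exact hs.implicitFunction_apply_image hr
    have hψ' : HasDerivAt ψ v 0 := by
      have h1 : HasDerivAt (fun t : ℝ => t • (⟨v, hv⟩ : (fderiv ℝ f p).ker)) ⟨v, hv⟩ 0 := by
        simpa using (hasDerivAt_id (0 : ℝ)).smul_const (⟨v, hv⟩ : (fderiv ℝ f p).ker)
      have h2 := hs.to_implicitFunction hr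
      have h3 : HasFDerivAt (hs.implicitFunction f (fderiv ℝ f p) hr (f p))
        (fderiv ℝ f p).ker.subtypeL ((0 : ℝ) • (⟨v, hv⟩ : (fderiv ℝ f p).ker)) := by
        simpa using h2.hasFDerivAt
      exact h3.comp_hasDerivAt (0 : ℝ) h1
    have hψS : ∀ᶠ t in 𝓝 (0 : ℝ), ψ t ∈ S := by
      have h1 : Tendsto (fun t : ℝ => (f p, t • (⟨v, hv⟩ : (fderiv ℝ f p).ker))) (𝓝 0)
          (𝓝 (f p, 0)) := by
        have : Continuous fun t : ℝ => (f p, t • (⟨v, hv⟩ : (fderiv ℝ f p).ker)) := by fun_prop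
        simpa using this.tendsto 0
      have h2 := h1.eventually (hs.map_implicitFunction_eq hr)
      have h3 : ∀ᶠ t in 𝓝 (0 : ℝ), ψ t ∈ U :=
        hψ'.continuousAt.eventually (hU.mem_nhds (by rwa [hψ0]))
      filter_upwards [h2, h3] with t ht2 ht3
      exact (hmem _ ht3).2 (ht2.trans hf0)
    classical
    -- The implicit curve lies in `S` only near `0`, while `tangentDir` asks for curves that stay in
    -- `S` for all times; resetting it to `p` elsewhere keeps the derivative.
    refine ⟨fun t => if ψ t ∈ S then ψ t else p, fun t => ?_, ?_, ?_⟩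
    · dsimp only
      split_ifs with h
      exacts [h, hp]
    · simp [hψ0]
    · refine hψ'.congr_of_eventuallyEq ?_
      filter_upwards [hψS] with t ht
      simp [ht]

theorem IsSubmanifold.finrank_tangentDir (hS : IsSubmanifold k S)
    {p : EuclideanSpace ℝ (Fin d)} (hp : p ∈ S) :
    Module.finrank ℝ (tangentDir S p) = k := by
  obtain ⟨c, U, f, hkc, hU, hpU, hf, hsurj, hSU⟩ := hS p hp
  rw [tangentDir_eq_ker hp hU hpU hf (hsurj p hpU) hSU]
  have h := LinearMap.finrank_range_add_finrank_ker (fderiv ℝ f p).toLinearMap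
  rw [LinearMap.range_eq_top.2 (hsurj p hpU), finrank_top, finrank_euclideanSpace_fin,
    finrank_euclideanSpace_fin] at h
  omega

theorem IsSubmanifold.finrank_normal (hS : IsSubmanifold k S)
    {p : EuclideanSpace ℝ (Fin d)} (hp : p ∈ S) :
    k + Module.finrank ℝ (tangentDir S p)ᗮ = d := by
  have := (tangentDir S p).finrank_add_finrank_orthogonal
  rwa [hS.finrank_tangentDir hp, finrank_euclideanSpace_fin] at this

/-- A `C²` submanifold has a small empty ball tangent to it in every normal direction. -/
theorem IsSubmanifold.exists_empty_ball (hS : IsSubmanifold k S)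
    {p n : EuclideanSpace ℝ (Fin d)} (hp : p ∈ S) (hn : n ∈ (tangentDir S p)ᗮ) (hn1 : ‖n‖ = 1) :
    ∃ r > 0, ∀ w ∈ S, r ≤ dist (p + r • n) w := by
  obtain ⟨c, U, f, hkc, hU, hpU, hf, hsurj, hSU⟩ := hS p hp
  have hfU : ∀ q ∈ U, q ∈ S → f q = 0 := fun q hq hqS =>
    ((Set.ext_iff.1 hSU q).1 ⟨hqS, hq⟩).2
  have hfp : ContDiffAt ℝ 2 f p := hf.contDiffAt (hU.mem_nhds hpU)
  -- Normals are the range of the adjoint of the derivative, so the normal component of `w - p` is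
  -- controlled by the second-order Taylor error of `f`.
  obtain ⟨a, ha⟩ : ∃ a, LinearMap.adjoint (fderiv ℝ f p).toLinearMap a = n := by
    rw [tangentDir_eq_ker hp hU hpU hf (hsurj p hpU) hSU] at hn
    have := LinearMap.orthogonal_ker (fderiv ℝ f p).toLinearMap
    rw [this] at hn
    exact hn
  have hna : ∀ v, inner ℝ n v = inner ℝ a (fderiv ℝ f p v) := fun v => by
    rw [← ha, LinearMap.adjoint_inner_left]; rfl
  have hf1 : ContDiffAt ℝ 1 (fderiv ℝ f) p := hfp.fderiv_right (by norm_num)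
  obtain ⟨K, t, ht, hK⟩ := hf1.exists_lipschitzOnWith
  obtain ⟨δ, hδ, hball⟩ := Metric.mem_nhds_iff.1 (inter_mem ht (hU.mem_nhds hpU))
  have hquad : ∀ w ∈ S, ‖w - p‖ < δ → inner ℝ n (w - p) ≤ ‖a‖ * K * ‖w - p‖ ^ 2 := by
    intro w hw hwδ
    have hsub : ∀ z ∈ Metric.closedBall p ‖w - p‖, z ∈ Metric.ball p δ := fun z hz =>
      (Metric.mem_closedBall.1 hz).trans_lt hwδ
    have hwm : w ∈ Metric.closedBall p ‖w - p‖ := by simp [dist_eq_norm]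
    have hpm : p ∈ Metric.closedBall p ‖w - p‖ := by simp
    have h1 := (convex_closedBall p ‖w - p‖).norm_image_sub_le_of_norm_fderiv_le' (𝕜 := ℝ)
      (f := f) (φ := fderiv ℝ f p) (C := K * ‖w - p‖) (fun z hz =>
        (hf.contDiffAt (hU.mem_nhds (hball (hsub z hz)).2)).differentiableAt (by norm_num))
      (fun z hz => by
        have := hK.dist_le_mul z (hball (hsub z hz)).1 p (hball (hsub p hpm)).1
        rw [dist_eq_norm] at this
        refine this.trans ?_
        gcongr
        exact hz) hpm hwm
    rw [hfU w (hball (hsub w hwm)).2 hw, hfU p hpU hp, sub_zero, zero_sub, norm_neg] at h1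
    rw [hna]
    calc inner ℝ a (fderiv ℝ f p (w - p)) ≤ ‖a‖ * ‖fderiv ℝ f p (w - p)‖ := real_inner_le_norm _ _
      _ ≤ ‖a‖ * (K * ‖w - p‖ * ‖w - p‖) := by gcongr
      _ = _ := by ring
  set C : ℝ := ‖a‖ * K + 1 with hC
  have hC0 : 0 < C := by positivity
  -- `1 / (2 * C)` handles points within `δ` of `p` through the quadratic bound, `δ / 2` handles the
  -- rest.
  set r := min (δ / 2) (1 / (2 * C)) with hr
  have hr0 : 0 < r := lt_min (by positivity) (by positivity)
  have hr1 : 2 * r ≤ δ := by have := min_le_left (δ / 2) (1 / (2 * C)); linarith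
  have hr2 : 2 * r * C ≤ 1 := by
    have : r ≤ 1 / (2 * C) := min_le_right _ _
    rw [le_div_iff₀ (by positivity)] at this
    linarith
  refine ⟨r, hr0, fun w hw => ?_⟩
  have key : 2 * r * inner ℝ n (w - p) ≤ ‖w - p‖ ^ 2 := by
    by_cases h : ‖w - p‖ < δ
    · have h1 := hquad w hw h
      have h2 : ‖a‖ * K * ‖w - p‖ ^ 2 ≤ C * ‖w - p‖ ^ 2 := by gcongr; linarith
      have h3 : 2 * r * inner ℝ n (w - p) ≤ 2 * r * (C * ‖w - p‖ ^ 2) := by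
        gcongr; exact h1.trans h2
      nlinarith [sq_nonneg ‖w - p‖]
    · have h1 : inner ℝ n (w - p) ≤ ‖n‖ * ‖w - p‖ := real_inner_le_norm _ _
      rw [hn1, one_mul] at h1
      nlinarith [norm_nonneg (w - p)]
  rw [dist_eq_norm]
  refine le_of_sq_le_sq ?_ (norm_nonneg _)
  rw [show p + r • n - w = r • n - (w - p) by abel, norm_sub_sq_real, real_inner_smul_left,
    norm_smul, hn1, mul_one, Real.norm_of_nonneg hr0.le]
  linarith

/-- The ball of any radius tangent to a compact `C²` submanifold at `p` is empty if the segment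
from `p` to its center avoids the medial axis. -/
theorem IsSubmanifold.empty_ball (hS : IsSubmanifold k S) (hSc : IsCompact S)
    {p n : EuclideanSpace ℝ (Fin d)} (hp : p ∈ S) (hn : n ∈ (tangentDir S p)ᗮ) (hn1 : ‖n‖ = 1)
    {r : ℝ} (hr : 0 ≤ r) (hM : ∀ s, 0 < s → s < r → p + s • n ∉ medialAxis S) :
    ∀ w ∈ S, r ≤ dist (p + r • n) w := by
  rcases hr.eq_or_lt with rfl | hr
  · exact fun w _ => dist_nonneg
  obtain ⟨r₀, hr₀, h₀⟩ := hS.exists_empty_ball hp hn hn1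
  -- The target radius `r` may be below `r₀`, so growth starts from the smaller of the two balls.
  have hmin : 0 < min r₀ r := lt_min hr₀ hr
  refine empty_ball_extension hSc hp hn1 hmin (min_le_right _ _) (fun w hw => ?_)
    fun s hs => hM s (hmin.trans_le hs)
  have h1 := h₀ w hw
  have h2 := dist_triangle (p + r₀ • n) (p + min r₀ r • n) w
  have h3 : dist (p + r₀ • n) (p + min r₀ r • n) = r₀ - min r₀ r := by
    rw [dist_add_left, dist_eq_norm, ← sub_smul, norm_smul, hn1, mul_one,
      Real.norm_of_nonneg (sub_nonneg.2 (min_le_left _ _))]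
  linarith

end Submanifold

end SurfApprox

namespace SurfApprox

open Filter Topology

/-! ### Normal variation at unit feature size -/

section NormalVariation

variable {E : Type*} [NormedAddCommGroup E] [InnerProductSpace ℝ E]

/-- `S` is a compact set through the origin with normal spaces `N`, and the open unit ball is free
of medial axis points of `S`. The last two fields say that empty balls and local minima of
projected distances produce normal vectors. -/
structure UnitFeature (S : Set E) (N : E → Submodule ℝ E) : Prop where
  isCompact : IsCompact S
  zero_mem : (0 : E) ∈ S
  empty_ball : ∀ z ∈ S, ‖z‖ < 1 → ∀ n ∈ N z, ‖n‖ = 1 → ∀ r : ℝ, 0 ≤ r → ‖z + r • n‖ ≤ 1 →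
    ∀ w ∈ S, r ≤ ‖z + r • n - w‖
  mem_of_empty_ball : ∀ z ∈ S, ∀ n : E, ∀ r : ℝ, 0 < r →
    (∀ w ∈ S, r * ‖n‖ ≤ ‖z + r • n - w‖) → n ∈ N z
  mem_of_isLocalMinOn : ∀ z ∈ S, ∀ T : Submodule ℝ E, ∀ [T.HasOrthogonalProjection], ∀ x ∈ T,
    IsLocalMinOn (fun w => ‖x - T.starProjection w‖) S z → x - T.starProjection z ∈ N z

theorem norm_sq_eq_starProjection (K : Submodule ℝ E) [K.HasOrthogonalProjection] (z : E) :
    ‖z‖ ^ 2 = ‖K.starProjection z‖ ^ 2 + ‖Kᗮ.starProjection z‖ ^ 2 := by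
  have h : z = K.starProjection z + Kᗮ.starProjection z :=
    (Submodule.starProjection_add_starProjection_orthogonal z).symm
  conv_lhs => rw [h]
  rw [norm_add_sq_real, Submodule.inner_right_of_mem_orthogonal
    (Submodule.starProjection_apply_mem K z) (Submodule.starProjection_apply_mem _ z)]
  ring

theorem inner_eq_starProjection (K : Submodule ℝ E) [K.HasOrthogonalProjection] (z m : E) :
    inner ℝ z m = inner ℝ (K.starProjection z) (K.starProjection m) +
      inner ℝ (Kᗮ.starProjection z) (Kᗮ.starProjection m) := by
  have h : ∀ z, z = K.starProjection z + Kᗮ.starProjection z := fun z =>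
    (Submodule.starProjection_add_starProjection_orthogonal z).symm
  conv_lhs => rw [h z, h m]
  rw [inner_add_left, inner_add_right, inner_add_right,
    Submodule.inner_right_of_mem_orthogonal
      (Submodule.starProjection_apply_mem K z) (Submodule.starProjection_apply_mem _ m),
    Submodule.inner_left_of_mem_orthogonal
      (Submodule.starProjection_apply_mem K m) (Submodule.starProjection_apply_mem _ z)]
  ring

/-- Here `b`, `a` are the normal and tangential lengths of the centre, `y`, `ξ` those of a surface
point, and `h` says that the point is outside the ball. After squaring and cancelling `1 - r` a
quadratic inequality in `b` remains, whose positive root is `(r ^ 2 + 2 * r - 1) / 2`. -/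
theorem center_arith {r a b ξ y i : ℝ} (hr : 3 / 4 ≤ r) (hr1 : r < 1) (hb : 0 ≤ b)
    (hlt : b < (r ^ 2 + 2 * r - 1) / 2) (ha : 0 ≤ a) (hab : b ^ 2 + a ^ 2 = 1) (hξ : 0 ≤ ξ)
    (hξ2 : ξ ^ 2 = (1 - r) * (3 + r) / 4) (hy : 0 ≤ y) (hyr : y ≤ (1 - r) / 2)
    (hi : ξ * a - y * b ≤ i) (h : r ^ 2 ≤ 1 - 2 * i + (y ^ 2 + (1 - r) * (3 + r) / 4)) :
    False := by
  have h2 : 2 * (ξ * a) ≤ (1 - r) * (2 + r + b) := by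
    have h3 : y ^ 2 ≤ ((1 - r) / 2) ^ 2 := by gcongr
    have h4 : y * b ≤ (1 - r) / 2 * b := by gcongr
    linarith
  have h3 : (2 * (ξ * a)) ^ 2 ≤ ((1 - r) * (2 + r + b)) ^ 2 := by
    gcongr
  have h4 : (1 - r) * ((3 + r) * (1 - b ^ 2)) ≤ (1 - r) * ((1 - r) * (2 + r + b) ^ 2) := by
    have : (2 * (ξ * a)) ^ 2 = (1 - r) * (3 + r) * (1 - b ^ 2) := by
      rw [mul_pow, mul_pow, hξ2, show a ^ 2 = 1 - b ^ 2 by linarith]; ring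
    rw [this] at h3
    linarith
  have h5 := le_of_mul_le_mul_left h4 (by linarith)
  have h6 : 0 < ((r ^ 2 + 2 * r - 1) / 2 - b) *
      (b + (r ^ 2 + 2 * r - 1) / 2 + (1 - r) * (2 + r) / 2) :=
    mul_pos (by linarith) (by nlinarith)
  linarith

/-- Weighting `h1` by `w + β` and `h2` by `w - β` cancels the unknown inner product `c`. -/
theorem normal_part_arith {δ β w X Q c : ℝ} (hδ : 3 / 4 ≤ 1 - δ ^ 2) (hw0 : 0 < w)
    (hw2 : w ^ 2 = β ^ 2 + (1 - δ ^ 2)) (hm : 0 < w - β) (hp : 0 < w + β)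
    (hQ : Q ^ 2 ≤ (δ ^ 2 / 2) ^ 2)
    (h1 : ((w - β) * (1 - β) - δ ^ 2 / 2) ^ 2 ≤
      Q ^ 2 + 2 * ((w - β) * c) + ((w - β) * X) ^ 2)
    (h2 : ((w + β) * (1 + β) - δ ^ 2 / 2) ^ 2 ≤
      Q ^ 2 + 2 * ((w + β) * -c) + ((w + β) * X) ^ 2) :
    1 - δ ^ 2 / w ≤ X ^ 2 := by
  have hprod : (w - β) * (w + β) = 1 - δ ^ 2 := by linarith
  have h4 : (w + β) * ((w - β) * (1 - β) - δ ^ 2 / 2) ^ 2 +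
      (w - β) * ((w + β) * (1 + β) - δ ^ 2 / 2) ^ 2 ≤
      2 * w * (Q ^ 2 + (1 - δ ^ 2) * X ^ 2) := by
    rw [← hprod]
    have := mul_le_mul_of_nonneg_left h1 hp.le
    have := mul_le_mul_of_nonneg_left h2 hm.le
    linarith
  have h5 : (w + β) * ((w - β) * (1 - β) - δ ^ 2 / 2) ^ 2 +
      (w - β) * ((w + β) * (1 + β) - δ ^ 2 / 2) ^ 2 = 2 * w * (δ ^ 2 / 2) ^ 2 +
        ((w - β) * (w + β)) * (2 * w * (1 + β ^ 2) + 4 * β ^ 2 - 2 * δ ^ 2) := by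
    ring
  rw [h5, hprod] at h4
  have h6 : (1 - δ ^ 2) * (2 * w * (1 + β ^ 2) + 4 * β ^ 2 - 2 * δ ^ 2) ≤
      (1 - δ ^ 2) * (2 * w * X ^ 2) := by
    have := mul_le_mul_of_nonneg_left hQ hw0.le
    linarith
  have h7 := le_of_mul_le_mul_left h6 (by linarith)
  rw [sub_le_iff_le_add, ← sub_le_iff_le_add', le_div_iff₀ hw0]
  have := mul_nonneg hw0.le (sq_nonneg β)
  linarith [sq_nonneg β]

/-- The lower bounds `1 / 2` against `|q| ≤ 1 / 8` force opposite signs inside the two absolute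
values; adding then gives `2w|x| ≥ 2w + 2β² - δ²`. Knowing the signs saves a factor of two over
squaring. -/
theorem normal_part_arith_codim_one {δ β w x q : ℝ} (hδ : 3 / 4 ≤ 1 - δ ^ 2) (hw0 : 0 < w)
    (hm : 0 < w - β) (hp : 0 < w + β) (hq : |q| ≤ δ ^ 2 / 2)
    (hm' : 1 / 2 ≤ (w - β) * (1 - β) - δ ^ 2 / 2) (hp' : 1 / 2 ≤ (w + β) * (1 + β) - δ ^ 2 / 2)
    (h1 : (w - β) * (1 - β) - δ ^ 2 / 2 ≤ |q + (w - β) * x|)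
    (h2 : (w + β) * (1 + β) - δ ^ 2 / 2 ≤ |q - (w + β) * x|) :
    1 - δ ^ 2 / (2 * w) ≤ |x| := by
  rw [sub_le_iff_le_add, ← sub_le_iff_le_add', le_div_iff₀ (by positivity)]
  obtain ⟨hq1, hq2⟩ := abs_le.1 hq
  rcases le_total 0 x with hx | hx
  · have hx1 : 0 ≤ (w - β) * x := by positivity
    have hx2 : 0 ≤ (w + β) * x := by positivity
    rw [abs_of_nonneg hx]
    rcases le_abs'.1 h1 with h1 | h1 <;> rcases le_abs'.1 h2 with h2 | h2 <;>
      linarith [sq_nonneg β]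
  · have hx1 : 0 ≤ (w - β) * -x := mul_nonneg hm.le (by linarith)
    have hx2 : 0 ≤ (w + β) * -x := mul_nonneg hp.le (by linarith)
    rw [abs_of_nonpos hx]
    rcases le_abs'.1 h1 with h1 | h1 <;> rcases le_abs'.1 h2 with h2 | h2 <;>
      linarith [sq_nonneg β]

namespace UnitFeature

variable {S : Set E} {N : E → Submodule ℝ E}

theorem radius_le_one (h : UnitFeature S N) {q n : E} (hq : q ∈ S) (hq1 : ‖q‖ < 1)
    (hn : n ∈ N q) (hn1 : ‖n‖ = 1) {r : ℝ} (hr : 0 ≤ r) (hm : ‖q + r • n‖ = 1) : r ≤ 1 := by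
  have := h.empty_ball q hq hq1 n hn hn1 r hr hm.le 0 h.zero_mem
  rwa [sub_zero, hm] at this

variable [FiniteDimensional ℝ E]

/-- `z` is outside the unit ball tangent at `0` in the direction of its own normal part. -/
theorem norm_normal_part_le (h : UnitFeature S N) {z : E} (hz : z ∈ S) :
    ‖(N 0).starProjection z‖ ≤ ‖z‖ ^ 2 / 2 := by
  set y := (N 0).starProjection z with hy
  rcases eq_or_ne y 0 with h0 | h0
  · rw [h0, norm_zero]; positivity
  have hy0 : 0 < ‖y‖ := norm_pos_iff.2 h0
  have hym : y ∈ N 0 := Submodule.starProjection_apply_mem _ _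
  have hn1 : ‖‖y‖⁻¹ • y‖ = 1 := by rw [norm_smul, norm_inv, norm_norm, inv_mul_cancel₀ hy0.ne']
  have h1 := h.empty_ball 0 h.zero_mem (by simp) (‖y‖⁻¹ • y) ((N 0).smul_mem _ hym) hn1 1
    zero_le_one (by simp [hn1]) z hz
  rw [zero_add, one_smul] at h1
  have h2 : inner ℝ (‖y‖⁻¹ • y) z = ‖y‖ := by
    have h4 : inner ℝ y z = ‖y‖ ^ 2 := by
      rw [← real_inner_self_eq_norm_sq]
      nth_rw 1 [← Submodule.starProjection_eq_self_iff.2 hym]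
      rw [Submodule.inner_starProjection_left_eq_right]
    rw [real_inner_smul_left, h4]
    field_simp
  have h3 : 1 ≤ ‖‖y‖⁻¹ • y - z‖ ^ 2 := one_le_pow₀ h1
  rw [norm_sub_sq_real, hn1, h2] at h3
  linarith

/-- If `S` has no vertical normals at points closer than `δ`, then it covers a ball of its tangent
space at the origin. -/
theorem exists_tangent_part_eq (h : UnitFeature S N) {δ : ℝ} (hδ0 : 0 ≤ δ)
    (hvert : ∀ z ∈ S, ‖z‖ < δ → ∀ n ∈ N z, n ∈ (N 0)ᗮ → n = 0)
    {x : E} (hx : x ∈ (N 0)ᗮ) (hxδ : ‖x‖ ^ 2 ≤ δ ^ 2 - δ ^ 4 / 4) :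
    ∃ z ∈ S, ‖z‖ ≤ δ ∧ (N 0)ᗮ.starProjection z = x := by
  set T := (N 0)ᗮ with hT
  set A : Set E := T.starProjection '' (S ∩ Metric.closedBall 0 δ) with hA
  have hSc : IsCompact (S ∩ Metric.closedBall 0 δ) := h.isCompact.inter_right
    Metric.isClosed_closedBall
  have hAc : IsCompact A := hSc.image T.starProjection.continuous
  have h0A : (0 : E) ∈ A := ⟨0, ⟨h.zero_mem, by simpa using hδ0⟩, by simp⟩
  -- A point at distance exactly `δ` has normal part at most `δ ^ 2 / 2`, hence squared tangential
  -- part at least `δ ^ 2 - δ ^ 4 / 4`.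
  have hclose : ∀ z ∈ S, ‖z‖ ≤ δ → ‖T.starProjection z‖ ^ 2 < δ ^ 2 - δ ^ 4 / 4 → ‖z‖ < δ := by
    intro z hz hzδ hlt
    refine lt_of_le_of_ne hzδ fun heq => ?_
    have h1 := norm_sq_eq_starProjection (N 0) z
    have h2 := h.norm_normal_part_le hz
    have h3 : ‖(N 0).starProjection z‖ ^ 2 ≤ (‖z‖ ^ 2 / 2) ^ 2 := by gcongr
    rw [heq] at h1 h3
    nlinarith
  suffices hopen : ∀ x ∈ T, ‖x‖ ^ 2 < δ ^ 2 - δ ^ 4 / 4 → x ∈ A by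
    have hxA : x ∈ A := by
      refine hAc.isClosed.mem_of_tendsto (f := fun s : ℝ => s • x) (b := 𝓝[<] 1) ?_ ?_
      · have : ContinuousAt (fun s : ℝ => s • x) 1 := by fun_prop
        simpa using this.tendsto.mono_left nhdsWithin_le_nhds
      · filter_upwards [Ioo_mem_nhdsLT (show (0 : ℝ) < 1 by norm_num)] with s hs
        rcases eq_or_ne x 0 with rfl | hx0
        · simpa using h0A
        refine hopen _ (T.smul_mem _ hx) ?_
        rw [norm_smul, Real.norm_of_nonneg hs.1.le, mul_pow]
        have h1 : 0 < ‖x‖ ^ 2 := by positivity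
        have h2 : s ^ 2 < 1 := by nlinarith [hs.1, hs.2]
        nlinarith
    obtain ⟨z, ⟨hz, hzδ⟩, rfl⟩ := hxA
    exact ⟨z, hz, by simpa using hzδ, rfl⟩
  intro x hx hxlt
  by_contra hxA
  have hGc : IsCompact (Set.Icc (0 : ℝ) 1 ∩ {s | s • x ∈ A}) :=
    isCompact_Icc.inter_right (hAc.isClosed.preimage (by fun_prop))
  obtain ⟨s, ⟨hs1, hs2⟩, hsmax⟩ := hGc.exists_isGreatest
    ⟨0, ⟨le_refl _, zero_le_one⟩, by simpa using h0A⟩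
  have hs1' : s < 1 := lt_of_le_of_ne hs1.2 fun h => hxA (by simpa [h] using hs2)
  -- The midpoint makes `s' + (s' - s) = 1`, so the covered point closest to `s' • x` has norm at
  -- most `‖x‖` and comes from the interior of the `δ`-ball. The minimizing displacement is then a
  -- normal lying in `T`, which `hvert` forces to vanish.
  set s' := (1 + s) / 2 with hs'
  have hs'A : s' • x ∉ A := fun hmem => by
    have : s' ≤ s := hsmax ⟨⟨by linarith [hs1.1], by linarith⟩, hmem⟩
    linarith
  obtain ⟨z, ⟨hz, hzδ⟩, hzmin⟩ := hSc.exists_isMinOn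
    (⟨0, h.zero_mem, by simpa using hδ0⟩ : (S ∩ Metric.closedBall 0 δ).Nonempty)
    (f := fun w => ‖s' • x - T.starProjection w‖) (by fun_prop)
  have hle : ‖s' • x - T.starProjection z‖ ≤ (s' - s) * ‖x‖ := by
    obtain ⟨w, hw, hwx⟩ := hs2
    have h1 : ‖s' • x - T.starProjection z‖ ≤ ‖s' • x - T.starProjection w‖ := hzmin hw
    rw [hwx, ← sub_smul, norm_smul, Real.norm_of_nonneg (by linarith)] at h1
    exact h1
  have hzx : ‖T.starProjection z‖ ≤ ‖x‖ := by
    have h1 := norm_sub_le (s' • x) (s' • x - T.starProjection z)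
    rw [sub_sub_cancel, norm_smul, Real.norm_of_nonneg (by linarith [hs1.1])] at h1
    nlinarith [norm_nonneg x]
  have hzlt : ‖z‖ < δ := by
    refine hclose z hz (by simpa using hzδ) (lt_of_le_of_lt ?_ hxlt)
    gcongr
  have hmin : IsLocalMinOn (fun w => ‖s' • x - T.starProjection w‖) S z := by
    filter_upwards [self_mem_nhdsWithin, mem_nhdsWithin_of_mem_nhds
      (Metric.isOpen_ball.mem_nhds (show z ∈ Metric.ball 0 δ by simpa using hzlt))] with w hw hw2
    exact hzmin ⟨hw, Metric.ball_subset_closedBall hw2⟩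
  have hxT := T.smul_mem s' hx
  have hnorm := h.mem_of_isLocalMinOn z hz T _ hxT hmin
  have h0 := hvert z hz hzlt _ hnorm
    (T.sub_mem hxT (Submodule.starProjection_apply_mem _ _))
  exact hs'A ⟨z, ⟨hz, hzδ⟩, (sub_eq_zero.1 h0).symm⟩

/-- The center on the unit sphere of an empty ball that is tangent to `S` at `q` has a large
component normal to `S` at the origin. -/
theorem le_norm_normal_part_center (h : UnitFeature S N) {q n : E} (hq : q ∈ S)
    (hq2 : ‖q‖ ≤ 1 / 2) (hn : n ∈ N q) (hn1 : ‖n‖ = 1)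
    (hvert : ∀ z ∈ S, ‖z‖ < ‖q‖ → ∀ n ∈ N z, n ∈ (N 0)ᗮ → n = 0)
    {r : ℝ} (hm : ‖q + r • n‖ = 1) (hr0 : 1 - ‖q‖ ^ 2 ≤ r) :
    (r ^ 2 + 2 * r - 1) / 2 ≤ ‖(N 0).starProjection (q + r • n)‖ := by
  set m := q + r • n with hmdef
  have hq0 := norm_nonneg q
  have hr34 : 3 / 4 ≤ r := by nlinarith
  have hr1 : r ≤ 1 := h.radius_le_one hq (by linarith) hn hn1 (by linarith) hm
  set b := ‖(N 0).starProjection m‖ with hb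
  set a := ‖(N 0)ᗮ.starProjection m‖ with ha
  have hb0 : 0 ≤ b := norm_nonneg _
  have hab : 1 = b ^ 2 + a ^ 2 := by
    have := norm_sq_eq_starProjection (N 0) m
    rw [hm] at this; linarith
  by_contra! hlt
  have ha0 : 0 < a := by
    refine lt_of_le_of_ne (norm_nonneg _) fun h0 => ?_
    rw [← h0] at hab
    have : b < 1 := by nlinarith
    nlinarith
  have hempty := h.empty_ball q hq (by linarith) n hn hn1 r (by linarith) hm.le
  rcases hr1.eq_or_lt with rfl | hr1
  -- For `r = 1` the ball also touches `S` at `0`, so its centre is purely normal there.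
  · have hmN : m ∈ N 0 := by
      refine h.mem_of_empty_ball 0 h.zero_mem m 1 one_pos fun w hw => ?_
      rw [hm, zero_add, one_smul, mul_one]
      exact hempty w hw
    have : (N 0)ᗮ.starProjection m = 0 :=
      (Submodule.starProjection_apply_eq_zero_iff _).2 (by simpa using hmN)
    rw [ha, this, norm_zero] at ha0
    exact ha0.false
  -- This is the tangential length of a point of squared norm `1 - r` on a unit sphere tangent at
  -- `0`: `ξ² = (1 - r) - ((1 - r) / 2)²`. Since `1 - r ≤ ‖q‖²`, it lies in the covered disc.
  set ξ := √((1 - r) * (3 + r) / 4) with hξ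
  have hξ2 : ξ ^ 2 = (1 - r) * (3 + r) / 4 := Real.sq_sqrt (by nlinarith)
  have hξ0 : 0 ≤ ξ := Real.sqrt_nonneg _
  obtain ⟨z, hz, hzq, hzx⟩ := h.exists_tangent_part_eq hq0 hvert
    (x := (ξ / a) • (N 0)ᗮ.starProjection m)
    (Submodule.smul_mem _ _ (Submodule.starProjection_apply_mem _ _)) (by
      rw [norm_smul, Real.norm_of_nonneg (by positivity), ← ha, div_mul_cancel₀ _ ha0.ne', hξ2]
      have h1 : 1 - r ≤ ‖q‖ ^ 2 := by linarith
      have h2 : ‖q‖ ^ 2 ≤ 1 := by nlinarith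
      nlinarith)
  have hzT : ‖(N 0)ᗮ.starProjection z‖ = ξ := by
    rw [hzx, norm_smul, Real.norm_of_nonneg (by positivity), ← ha, div_mul_cancel₀ _ ha0.ne']
  have hz2 := norm_sq_eq_starProjection (N 0) z
  have hzN := h.norm_normal_part_le hz
  set y := ‖(N 0).starProjection z‖ with hy
  have hy0 : 0 ≤ y := norm_nonneg _
  rw [hzT] at hz2
  have hzh : ‖z‖ ≤ 1 / 2 := hzq.trans hq2
  have hyρ : y ≤ (1 - r) / 2 := by
    have h1 : y ≤ 1 / 8 := by nlinarith [norm_nonneg z]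
    rw [hz2, hξ2] at hzN
    by_contra! hcon
    have h2 : 0 < (y - (1 - r) / 2) * (2 - (1 - r) / 2 - y) :=
      mul_pos (by linarith) (by linarith)
    linarith
  have hzm : ξ * a - y * b ≤ inner ℝ z m := by
    rw [inner_eq_starProjection (N 0), hzx, real_inner_smul_left, real_inner_self_eq_norm_sq, ← ha]
    have h1 : -(y * b) ≤ inner ℝ ((N 0).starProjection z) ((N 0).starProjection m) :=
      (abs_le.1 (abs_real_inner_le_norm _ _)).1
    have h2 : ξ / a * a ^ 2 = ξ * a := by field_simp
    linarith
  have h1 : r ^ 2 ≤ ‖m - z‖ ^ 2 := by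
    have := hempty z hz
    gcongr
  rw [norm_sub_sq_real, hm, real_inner_comm, hz2, hξ2] at h1
  exact center_arith hr34 hr1 hb0 hlt ha0.le hab.symm hξ0 hξ2 hy0 hyρ hzm (by linarith)

/-- The line through `q` along `n` meets the unit sphere in two points; the balls centred there and
tangent at `q` have radii `w - β` and `w + β`, with `β` the inner product of `q` and `n`. -/
theorem exists_center_bounds (h : UnitFeature S N) {q n : E} (hq : q ∈ S)
    (hq2 : ‖q‖ ≤ 1 / 2) (hn : n ∈ N q) (hn1 : ‖n‖ = 1)
    (hvert : ∀ z ∈ S, ‖z‖ < ‖q‖ → ∀ n ∈ N z, n ∈ (N 0)ᗮ → n = 0) :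
    ∃ β w : ℝ, √(1 - ‖q‖ ^ 2) ≤ w ∧ w ^ 2 = β ^ 2 + (1 - ‖q‖ ^ 2) ∧ 0 < w - β ∧ 0 < w + β ∧
      1 / 2 ≤ (w - β) * (1 - β) - ‖q‖ ^ 2 / 2 ∧ 1 / 2 ≤ (w + β) * (1 + β) - ‖q‖ ^ 2 / 2 ∧
      (w - β) * (1 - β) - ‖q‖ ^ 2 / 2 ≤
        ‖(N 0).starProjection q + (w - β) • (N 0).starProjection n‖ ∧
      (w + β) * (1 + β) - ‖q‖ ^ 2 / 2 ≤
        ‖(N 0).starProjection q - (w + β) • (N 0).starProjection n‖ := by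
  set δ := ‖q‖ with hδ
  have hδ0 : 0 ≤ δ := norm_nonneg q
  set β : ℝ := inner ℝ q n with hβ
  set w := √(β ^ 2 + (1 - δ ^ 2)) with hw
  have hs0 : 3 / 4 ≤ 1 - δ ^ 2 := by nlinarith
  have hw2 : w ^ 2 = β ^ 2 + (1 - δ ^ 2) := Real.sq_sqrt (by linarith [sq_nonneg β])
  have hw0 : 0 < w := Real.sqrt_pos.2 (by linarith [sq_nonneg β])
  have hsw : √(1 - δ ^ 2) ≤ w := Real.sqrt_le_sqrt (by linarith [sq_nonneg β])
  obtain ⟨hβw1, hβw2⟩ : -w < β ∧ β < w := abs_lt_of_sq_lt_sq' (by linarith) hw0.le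
  have hrp0 : 0 < w - β := by linarith
  have hrm0 : 0 < w + β := by linarith
  -- Power of `q` in the unit sphere. Both radii are at most `1`, so each is at least `1 - δ ^ 2`.
  have hprod : (w - β) * (w + β) = 1 - δ ^ 2 := by linarith
  have hmp : ‖q + (w - β) • n‖ = 1 := by
    rw [← sq_eq_sq₀ (norm_nonneg _) zero_le_one, norm_add_sq_real, real_inner_smul_right, norm_smul,
      hn1, Real.norm_of_nonneg hrp0.le, ← hδ, ← hβ]
    linarith
  have hmm : ‖q + (w + β) • (-n)‖ = 1 := by
    rw [← sq_eq_sq₀ (norm_nonneg _) zero_le_one, norm_add_sq_real, real_inner_smul_right, norm_smul,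
      norm_neg, hn1, Real.norm_of_nonneg hrm0.le, ← hδ, inner_neg_right, ← hβ]
    linarith
  have hn' : -n ∈ N q := (N q).neg_mem hn
  have hn1' : ‖-n‖ = 1 := by rw [norm_neg, hn1]
  have hq1 : ‖q‖ < 1 := by rw [← hδ]; linarith
  have hrp1 : w - β ≤ 1 := h.radius_le_one hq hq1 hn hn1 hrp0.le hmp
  have hrm1 : w + β ≤ 1 := h.radius_le_one hq hq1 hn' hn1' hrm0.le hmm
  have hrpl : 1 - δ ^ 2 ≤ w - β := hprod ▸ mul_le_of_le_one_right hrp0.le hrm1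
  have hrml : 1 - δ ^ 2 ≤ w + β := hprod ▸ mul_le_of_le_one_left hrm0.le hrp1
  have hBp := h.le_norm_normal_part_center hq hq2 hn hn1 hvert hmp hrpl
  have hBm := h.le_norm_normal_part_center hq hq2 hn' hn1' hvert hmm hrml
  rw [map_add, map_smul] at hBp hBm
  rw [map_neg, smul_neg, ← sub_eq_add_neg] at hBm
  have hBpe : ((w - β) ^ 2 + 2 * (w - β) - 1) / 2 = (w - β) * (1 - β) - δ ^ 2 / 2 := by linarith
  have hBme : ((w + β) ^ 2 + 2 * (w + β) - 1) / 2 = (w + β) * (1 + β) - δ ^ 2 / 2 := by linarith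
  have hB : ∀ r : ℝ, 1 - δ ^ 2 ≤ r → 1 / 2 ≤ (r ^ 2 + 2 * r - 1) / 2 := fun r hr => by
    nlinarith
  refine ⟨β, w, hsw, hw2, hrp0, hrm0, ?_, ?_, ?_, ?_⟩
  · rw [← hBpe]; exact hB _ hrpl
  · rw [← hBme]; exact hB _ hrml
  · rwa [← hBpe]
  · rwa [← hBme]

theorem norm_normal_part_sq_of_no_vertical (h : UnitFeature S N) {q n : E} (hq : q ∈ S)
    (hq2 : ‖q‖ ≤ 1 / 2) (hn : n ∈ N q) (hn1 : ‖n‖ = 1)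
    (hvert : ∀ z ∈ S, ‖z‖ < ‖q‖ → ∀ n ∈ N z, n ∈ (N 0)ᗮ → n = 0) :
    1 - ‖q‖ ^ 2 / √(1 - ‖q‖ ^ 2) ≤ ‖(N 0).starProjection n‖ ^ 2 := by
  obtain ⟨β, w, hsw, hw2, hm, hp, hm', hp', h1, h2⟩ := h.exists_center_bounds hq hq2 hn hn1 hvert
  have hs0 : 3 / 4 ≤ 1 - ‖q‖ ^ 2 := by nlinarith [norm_nonneg q]
  have hss : 0 < √(1 - ‖q‖ ^ 2) := Real.sqrt_pos.2 (by linarith)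
  have h1' := pow_le_pow_left₀ (by linarith) h1 2
  have h2' := pow_le_pow_left₀ (by linarith) h2 2
  rw [norm_add_sq_real, real_inner_smul_right, norm_smul, Real.norm_of_nonneg hm.le] at h1'
  rw [sub_eq_add_neg _ ((w + β) • _), ← smul_neg, norm_add_sq_real, real_inner_smul_right,
    norm_smul, Real.norm_of_nonneg hp.le, inner_neg_right, norm_neg] at h2'
  refine le_trans ?_ (normal_part_arith hs0 (hss.trans_le hsw) hw2 hm hp
    (pow_le_pow_left₀ (norm_nonneg _) (h.norm_normal_part_le hq) 2) h1' h2')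
  gcongr

/-- Near the origin no normal vector of `S` is tangent to `S` at the origin. -/
theorem eq_zero_of_mem_tangent (h : UnitFeature S N) {q n : E} (hq : q ∈ S) (hq2 : ‖q‖ ≤ 1 / 2)
    (hn : n ∈ N q) (hnT : n ∈ (N 0)ᗮ) : n = 0 := by
  by_contra hn0
  -- Being normal is encoded by an empty ball of radius `1 / 2`, a closed condition, so a violation
  -- nearest to `0` exists. No violation is closer, so the estimate applies there and contradicts a
  -- vanishing normal part.
  set W : Set (E × E) := (S ∩ Metric.closedBall 0 (1 / 2)) ×ˢ
    (Metric.sphere 0 1 ∩ ((N 0)ᗮ : Set E)) ∩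
      {z | ∀ w ∈ S, 1 / 2 ≤ ‖z.1 + (1 / 2 : ℝ) • z.2 - w‖} with hW
  have hWc : IsCompact W := by
    refine IsCompact.inter_right (((h.isCompact.inter_right Metric.isClosed_closedBall)).prod
      ((isCompact_sphere _ _).inter_right (Submodule.closed_of_finiteDimensional _))) ?_
    simp only [Set.ofPred_forall]
    exact isClosed_biInter fun w _ => isClosed_le continuous_const (by fun_prop)
  have hWmem : ∀ z ∈ S, ‖z‖ ≤ 1 / 2 → ∀ n ∈ N z, n ∈ (N 0)ᗮ → n ≠ 0 →
      (z, ‖n‖⁻¹ • n) ∈ W := by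
    intro z hz hz2 n hn hnT hn0
    have hn1 : ‖‖n‖⁻¹ • n‖ = 1 := norm_smul_inv_norm hn0
    refine ⟨⟨⟨hz, by simpa using hz2⟩, by simpa using hn1, Submodule.smul_mem _ _ hnT⟩, ?_⟩
    refine h.empty_ball z hz (by linarith) _ ((N z).smul_mem _ hn) hn1 _ (by norm_num) ?_
    have h1 := norm_add_le z ((1 / 2 : ℝ) • (‖n‖⁻¹ • n))
    rw [norm_smul, hn1, mul_one] at h1
    norm_num at h1 ⊢
    linarith
  obtain ⟨⟨z, m⟩, ⟨⟨⟨hz, hz2⟩, hm1, hmT⟩, hempty⟩, hmin⟩ := hWc.exists_isMinOn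
    ⟨_, hWmem q hq hq2 n hn hnT hn0⟩ (f := fun z => ‖z.1‖) (by fun_prop)
  simp only [Metric.mem_closedBall, dist_zero_right, mem_sphere_iff_norm, sub_zero] at hz2 hm1
  have hmN : m ∈ N z := h.mem_of_empty_ball z hz m (1 / 2) (by norm_num) fun w hw => by
    rw [hm1, mul_one]; exact hempty w hw
  have h1 := h.norm_normal_part_sq_of_no_vertical hz hz2 hmN hm1 fun z' hz' hlt n' hn' hnT' => by
    by_contra hn0'
    exact absurd (hmin (hWmem z' hz' (hlt.le.trans hz2) n' hn' hnT' hn0')) (not_le.2 hlt)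
  have h2 : (N 0).starProjection m = 0 := (Submodule.starProjection_apply_eq_zero_iff _).2 hmT
  rw [h2, norm_zero] at h1
  have hz4 : ‖z‖ ^ 2 ≤ 1 / 4 := by nlinarith [norm_nonneg z]
  have h3 : 3 / 4 ≤ √(1 - ‖z‖ ^ 2) := Real.le_sqrt_of_sq_le (by linarith)
  have h4 : ‖z‖ ^ 2 / √(1 - ‖z‖ ^ 2) < 1 := by
    rw [div_lt_one (by linarith)]; linarith
  linarith

theorem norm_normal_part_sq_ge (h : UnitFeature S N) {q n : E} (hq : q ∈ S)
    (hq2 : ‖q‖ ≤ 1 / 2) (hn : n ∈ N q) (hn1 : ‖n‖ = 1) :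
    1 - ‖q‖ ^ 2 / √(1 - ‖q‖ ^ 2) ≤ ‖(N 0).starProjection n‖ ^ 2 :=
  h.norm_normal_part_sq_of_no_vertical hq hq2 hn hn1 fun _ hz hlt _ hn hnT =>
    h.eq_zero_of_mem_tangent hz (hlt.le.trans hq2) hn hnT

theorem norm_normal_part_ge_of_finrank_eq_one (h : UnitFeature S N) {q n : E} (hq : q ∈ S)
    (hq2 : ‖q‖ ≤ 1 / 2) (hn : n ∈ N q) (hn1 : ‖n‖ = 1) (hfin : Module.finrank ℝ (N 0) = 1) :
    1 - ‖q‖ ^ 2 / (2 * √(1 - ‖q‖ ^ 2)) ≤ ‖(N 0).starProjection n‖ := by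
  obtain ⟨β, w, hsw, hw2, hm, hp, hm', hp', h1, h2⟩ := h.exists_center_bounds hq hq2 hn hn1
    fun _ hz hlt _ hn hnT => h.eq_zero_of_mem_tangent hz (hlt.le.trans hq2) hn hnT
  have hs0 : 3 / 4 ≤ 1 - ‖q‖ ^ 2 := by nlinarith [norm_nonneg q]
  have hss : 0 < √(1 - ‖q‖ ^ 2) := Real.sqrt_pos.2 (by linarith)
  obtain ⟨e, he1, hspan⟩ : ∃ e : E, ‖e‖ = 1 ∧ ∀ v ∈ N 0, ∃ c : ℝ, v = c • e := by
    obtain ⟨e, he0, he⟩ := finrank_eq_one_iff'.1 hfin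
    have he0' : (e : E) ≠ 0 := fun h => he0 (Subtype.ext h)
    have hen : ‖(e : E)‖ ≠ 0 := norm_ne_zero_iff.2 he0'
    refine ⟨‖(e : E)‖⁻¹ • (e : E), ?_, fun v hv => ?_⟩
    · rw [norm_smul, norm_inv, norm_norm, inv_mul_cancel₀ hen]
    · obtain ⟨c, hc⟩ := he ⟨v, hv⟩
      refine ⟨c * ‖(e : E)‖, ?_⟩
      rw [smul_smul, mul_assoc, mul_inv_cancel₀ hen, mul_one]
      exact (congrArg Subtype.val hc).symm
  obtain ⟨x, hx⟩ := hspan _ (Submodule.starProjection_apply_mem (N 0) q)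
  obtain ⟨y, hy⟩ := hspan _ (Submodule.starProjection_apply_mem (N 0) n)
  have hqN := h.norm_normal_part_le hq
  have hnorm : ∀ c : ℝ, ‖c • e‖ = |c| := fun c => by rw [norm_smul, he1, mul_one, Real.norm_eq_abs]
  rw [hx, hy, smul_smul, ← add_smul, hnorm] at h1
  rw [hx, hy, smul_smul, ← sub_smul, hnorm] at h2
  rw [hx, hnorm] at hqN
  rw [hy, hnorm]
  refine le_trans ?_ (normal_part_arith_codim_one hs0 (hss.trans_le hsw) hm hp hqN hm' hp' h1 h2)
  gcongr

end UnitFeature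

end NormalVariation

end SurfApprox

namespace SurfApprox

open Filter Topology InnerProductGeometry

/-! ### Angles between subspaces -/

section Angles

variable {E : Type*} [NormedAddCommGroup E] [InnerProductSpace ℝ E]

/-- Every line of `F` makes an angle of at most `θ` with some line of `G`. -/
def AngleLE (F G : Submodule ℝ E) (θ : ℝ) : Prop :=
  ∀ v ∈ F, v ≠ 0 → ∃ w ∈ G, w ≠ 0 ∧ angle v w ≤ θ

theorem lineAngle_nonneg (v w : E) : 0 ≤ lineAngle v w :=
  le_min (angle_nonneg v w) (sub_nonneg.2 (angle_le_pi v w))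

theorem AngleLE.maxMinAngle_le {F G : Submodule ℝ E} {θ : ℝ} (h : AngleLE F G θ) (hθ : 0 ≤ θ) :
    maxMinAngle F G ≤ θ := by
  refine Real.iSup_le (fun v => ?_) hθ
  obtain ⟨w, hw, hw0, hvw⟩ := h v.1 v.2.1 v.2.2
  have hbdd : BddBelow (Set.range fun w : {w : E // w ∈ G ∧ w ≠ 0} => lineAngle v.1 w.1) :=
    ⟨0, by rintro _ ⟨w, rfl⟩; exact lineAngle_nonneg _ _⟩
  exact (ciInf_le hbdd ⟨w, hw, hw0⟩).trans ((min_le_left _ _).trans hvw)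

theorem AngleLE.mono {F G : Submodule ℝ E} {θ θ' : ℝ} (h : AngleLE F G θ) (hθ : θ ≤ θ') :
    AngleLE F G θ' := fun v hv hv0 => by
  obtain ⟨w, hw, hw0, hvw⟩ := h v hv hv0
  exact ⟨w, hw, hw0, hvw.trans hθ⟩

theorem AngleLE.trans {F G H : Submodule ℝ E} {θ₁ θ₂ : ℝ} (h₁ : AngleLE F G θ₁)
    (h₂ : AngleLE G H θ₂) : AngleLE F H (θ₁ + θ₂) := fun v hv hv0 => by
  obtain ⟨w, hw, hw0, hvw⟩ := h₁ v hv hv0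
  obtain ⟨u, hu, hu0, hwu⟩ := h₂ w hw hw0
  exact ⟨u, hu, hu0, (angle_le_angle_add_angle v w u).trans (add_le_add hvw hwu)⟩

theorem angleLE_of_pi_div_two_le {F G : Submodule ℝ E} {θ : ℝ} (hθ : Real.pi / 2 ≤ θ)
    (hG : G ≠ ⊥) : AngleLE F G θ := fun v _ _ => by
  obtain ⟨w, hw, hw0⟩ := G.exists_mem_ne_zero_of_ne_bot hG
  rcases le_total (angle v w) (Real.pi / 2) with h | h
  · exact ⟨w, hw, hw0, h.trans hθ⟩
  · refine ⟨-w, G.neg_mem hw, neg_ne_zero.2 hw0, ?_⟩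
    rw [angle_neg_right]
    linarith

theorem angleLE_arccos {F G : Submodule ℝ E} [G.HasOrthogonalProjection] (hG : G ≠ ⊥) {c : ℝ}
    (h : ∀ v ∈ F, ‖v‖ = 1 → c ≤ ‖G.starProjection v‖) : AngleLE F G (Real.arccos c) := by
  rcases le_or_gt c 0 with hc | hc
  · refine angleLE_of_pi_div_two_le ?_ hG
    rw [← Real.arccos_zero]
    exact Real.arccos_le_arccos hc
  intro v hv hv0
  have hv1 : 0 < ‖v‖ := norm_pos_iff.2 hv0
  have h1 := h _ (F.smul_mem ‖v‖⁻¹ hv) (norm_smul_inv_norm hv0)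
  rw [map_smul, norm_smul, norm_inv, norm_norm, inv_mul_eq_div] at h1
  have h2 : 0 < ‖G.starProjection v‖ := by
    by_contra! h3
    have : ‖G.starProjection v‖ / ‖v‖ ≤ 0 := div_nonpos_of_nonpos_of_nonneg h3 hv1.le
    linarith
  refine ⟨G.starProjection v, Submodule.starProjection_apply_mem _ _, norm_pos_iff.1 h2, ?_⟩
  refine Real.arccos_le_arccos (h1.trans_eq ?_)
  have h3 : inner ℝ v (G.starProjection v) = ‖G.starProjection v‖ ^ 2 := by
    rw [inner_eq_starProjection G, Submodule.starProjection_eq_self_iff.2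
      (Submodule.starProjection_apply_mem G v), real_inner_self_eq_norm_sq,
      (Submodule.starProjection_apply_eq_zero_iff Gᗮ (v := G.starProjection v)).2
        (G.le_orthogonal_orthogonal (Submodule.starProjection_apply_mem G v)), inner_zero_right, add_zero]
  rw [h3]
  field_simp

/-- For `θ < π / 2` the projection from `F` to `G` kills no vector, hence is onto by dimension. Each
line of `G` is thus the projection of a line of `F`, and a line's angle with its projection is its
smallest angle with `G`. -/
theorem AngleLE.symm [FiniteDimensional ℝ E] {F G : Submodule ℝ E} {θ : ℝ}
    (hFG : Module.finrank ℝ F = Module.finrank ℝ G) (h : AngleLE F G θ) : AngleLE G F θ := by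
  rcases eq_or_ne F ⊥ with rfl | hF
  · have : G = ⊥ := Submodule.finrank_eq_zero.1 (by rw [← hFG, finrank_bot])
    subst this
    exact h
  rcases le_or_gt (Real.pi / 2) θ with hθ | hθ
  · exact angleLE_of_pi_div_two_le hθ hF
  have hθ0 : 0 ≤ θ := by
    obtain ⟨v, hv, hv0⟩ := F.exists_mem_ne_zero_of_ne_bot hF
    obtain ⟨w, -, -, hw⟩ := h v hv hv0
    exact (angle_nonneg v w).trans hw
  have hc : 0 < Real.cos θ := Real.cos_pos_of_mem_Ioo ⟨by linarith, hθ⟩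
  have hproj : ∀ v ∈ F, Real.cos θ * ‖v‖ ≤ ‖G.starProjection v‖ := by
    intro v hv
    rcases eq_or_ne v 0 with rfl | hv0
    · simp
    obtain ⟨w, hw, hw0, hvw⟩ := h v hv hv0
    have h1 : Real.cos θ ≤ Real.cos (angle v w) :=
      Real.cos_le_cos_of_nonneg_of_le_pi (angle_nonneg v w) (by linarith [Real.pi_pos]) hvw
    have h2 : inner ℝ v w = Real.cos (angle v w) * (‖v‖ * ‖w‖) :=
      (cos_angle_mul_norm_mul_norm v w).symm
    have h3 : inner ℝ v w ≤ ‖G.starProjection v‖ * ‖w‖ := by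
      have : inner ℝ v w = inner ℝ (G.starProjection v) w := by
        rw [Submodule.inner_starProjection_left_eq_right, Submodule.starProjection_eq_self_iff.2 hw]
      rw [this]
      exact real_inner_le_norm _ _
    have hw1 : 0 < ‖w‖ := norm_pos_iff.2 hw0
    refine le_of_mul_le_mul_right ?_ hw1
    calc Real.cos θ * ‖v‖ * ‖w‖ ≤ Real.cos (angle v w) * ‖v‖ * ‖w‖ := by gcongr
      _ = inner ℝ v w := by rw [h2]; ring
      _ ≤ _ := h3
  let A : F →ₗ[ℝ] G := G.orthogonalProjectionOnto.toLinearMap ∘ₗ F.subtype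
  have hA : ∀ v : F, ((A v : G) : E) = G.starProjection v := fun v => rfl
  have hinj : Function.Injective A := by
    rw [← LinearMap.ker_eq_bot, LinearMap.ker_eq_bot']
    intro v hv
    have h1 := hproj v v.2
    rw [← hA, hv, Submodule.coe_zero, norm_zero] at h1
    have : ‖(v : E)‖ ≤ 0 := by
      by_contra! h2
      exact absurd h1 (not_le.2 (mul_pos hc h2))
    exact Subtype.ext (norm_le_zero_iff.1 this)
  have hsurj := (LinearMap.injective_iff_surjective_of_finrank_eq_finrank hFG).1 hinj
  intro w hw hw0
  obtain ⟨v, hv⟩ := hsurj ⟨w, hw⟩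
  have hvw : G.starProjection (v : E) = w := by rw [← hA, hv]
  have hw1 : 0 < ‖w‖ := norm_pos_iff.2 hw0
  have hv0 : (v : E) ≠ 0 := fun h0 => hw0 (by rw [← hvw, h0, map_zero])
  have hv1 : 0 < ‖(v : E)‖ := norm_pos_iff.2 hv0
  refine ⟨v, v.2, hv0, ?_⟩
  rw [← Real.arccos_cos hθ0 (by linarith [Real.pi_pos])]
  refine Real.arccos_le_arccos ?_
  have h1 : inner ℝ w (v : E) = ‖w‖ ^ 2 := by
    rw [← real_inner_self_eq_norm_sq]
    nth_rw 3 [← hvw]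
    rw [← Submodule.inner_starProjection_left_eq_right, Submodule.starProjection_eq_self_iff.2 hw]
  have h2 := hproj v v.2
  rw [hvw] at h2
  rw [h1, le_div_iff₀ (by positivity)]
  nlinarith

theorem flatAngle_le [FiniteDimensional ℝ E] {F G : AffineSubspace ℝ E} {θ : ℝ} (hθ : 0 ≤ θ)
    (hFG : Module.finrank ℝ F.direction ≤ Module.finrank ℝ G.direction)
    (h : AngleLE F.direction G.direction θ) : flatAngle G F ≤ θ := by
  unfold flatAngle
  split_ifs with hle
  · exact (h.symm (le_antisymm hFG hle)).maxMinAngle_le hθ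
  · exact h.maxMinAngle_le hθ

end Angles

/-! ### Rescaling to unit feature size -/

section NormalVariation

variable {d k : ℕ} {S : Set (EuclideanSpace ℝ (Fin d))}

theorem IsSubmanifold.unitFeature (hS : IsSubmanifold k S) (hSc : IsCompact S)
    {p : EuclideanSpace ℝ (Fin d)} (hp : p ∈ S) {L : ℝ} (hL0 : 0 < L) (hL : L ≤ lfs S p) :
    UnitFeature ((fun w => L⁻¹ • (w - p)) '' S) fun z => (tangentDir S (p + L • z))ᗮ := by
  have hmem : ∀ z ∈ (fun w => L⁻¹ • (w - p)) '' S, p + L • z ∈ S := by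
    rintro _ ⟨w, hw, rfl⟩
    rwa [smul_inv_smul₀ hL0.ne', add_sub_cancel]
  have hback : ∀ w ∈ S, L⁻¹ • (w - p) ∈ (fun w => L⁻¹ • (w - p)) '' S := fun w hw => ⟨w, hw, rfl⟩
  have hdist : ∀ a b : EuclideanSpace ℝ (Fin d), dist (p + L • a) (p + L • b) = L * ‖a - b‖ :=
    fun a b => by
      rw [dist_add_left, dist_eq_norm, ← smul_sub, norm_smul, Real.norm_of_nonneg hL0.le]
  refine ⟨hSc.image (by fun_prop), ⟨p, hp, by simp⟩, ?_, ?_, ?_⟩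
  · intro z hz hz1 n hn hn1 r hr hm w hw
    have h1 := hS.empty_ball hSc (hmem z hz) hn hn1 (r := L * r) (by positivity) ?_ _ (hmem w hw)
    · rw [show p + L • z + (L * r) • n = p + L • (z + r • n) by
        rw [smul_add, smul_smul, add_assoc], hdist] at h1
      exact le_of_mul_le_mul_left h1 hL0
    intro s hs0 hs
    refine notMem_medialAxis_of_dist_lt_lfs (p := p) (lt_of_lt_of_le ?_ hL)
    have hr0 : 0 < r := by by_contra! h; nlinarith
    set t := s / (L * r) with ht
    have ht0 : 0 < t := by positivity
    have ht1 : t < 1 := by rw [ht, div_lt_one (by positivity)]; exact hs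
    have hst : s = L * (t * r) := by rw [ht]; field_simp
    -- Every earlier centre is a convex combination of `z`, strictly inside the unit ball, and the
    -- final centre, so it stays strictly inside.
    have heq : p + L • z + s • n = p + L • ((1 - t) • z + t • (z + r • n)) := by
      rw [hst]; module
    have h2 := hdist 0 ((1 - t) • z + t • (z + r • n))
    rw [smul_zero, add_zero, zero_sub, norm_neg] at h2
    rw [heq, h2]
    have h3 : ‖(1 - t) • z + t • (z + r • n)‖ ≤ (1 - t) * ‖z‖ + t * ‖z + r • n‖ := by
      refine (norm_add_le _ _).trans ?_
      rw [norm_smul, norm_smul, Real.norm_of_nonneg (by linarith), Real.norm_of_nonneg ht0.le]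
    have h4 : ‖(1 - t) • z + t • (z + r • n)‖ < 1 := by nlinarith
    nlinarith
  · intro z hz n r hr h
    have h1 : IsNearestPoint S (p + L • (z + r • n)) (p + L • z) := by
      refine ⟨hmem z hz, fun w hw => ?_⟩
      have h2 := h _ (hback w hw)
      have h3 : w = p + L • (L⁻¹ • (w - p)) := by rw [smul_inv_smul₀ hL0.ne', add_sub_cancel]
      rw [h3, hdist, hdist, add_sub_cancel_left, norm_smul, Real.norm_of_nonneg hr.le]
      gcongr
    have h2 := sub_mem_normal_of_isNearestPoint h1
    rw [add_sub_add_left_eq_sub, ← smul_sub, add_sub_cancel_left, smul_smul] at h2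
    exact (Submodule.smul_mem_iff _ (by positivity)).1 h2
  · intro z hz T _ x hx hmin
    have h1 : IsLocalMinOn (fun w => ‖(T.starProjection p + L • x) - T.starProjection w‖) S
        (p + L • z) := by
      have hcont : Continuous fun w : EuclideanSpace ℝ (Fin d) => L⁻¹ • (w - p) := by fun_prop
      have hz' : L⁻¹ • (p + L • z - p) = z := by
        rw [add_sub_cancel_left, inv_smul_smul₀ hL0.ne']
      have ht : Tendsto (fun w => L⁻¹ • (w - p)) (𝓝[S] (p + L • z))
          (𝓝[(fun w => L⁻¹ • (w - p)) '' S] z) := by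
        have := hcont.continuousWithinAt.tendsto_nhdsWithin_image (s := S) (x := p + L • z)
        rwa [hz'] at this
      have h2 := ht.eventually hmin
      refine h2.mono fun w hw => ?_
      have h3 : ∀ w, T.starProjection p + L • x - T.starProjection w =
          L • (x - T.starProjection (L⁻¹ • (w - p))) := fun w => by
        rw [map_smul, smul_sub, smul_inv_smul₀ hL0.ne', map_sub]; abel
      dsimp only
      rw [h3 w, h3, norm_smul, norm_smul, hz']
      gcongr
    have h2 := sub_starProjection_mem_normal T
      (T.add_mem (Submodule.starProjection_apply_mem T p) (T.smul_mem L hx)) h1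
    rw [map_add, add_sub_add_left_eq_sub, map_smul, ← smul_sub] at h2
    exact (Submodule.smul_mem_iff _ hL0.ne').1 h2

/-- Normal variation: the normal spaces at two points of `S` that are close relative to the local
feature size at one of them make a small angle. -/
theorem IsSubmanifold.angleLE_normal (hS : IsSubmanifold k S) (hSc : IsCompact S) (hkd : k < d)
    {p q : EuclideanSpace ℝ (Fin d)} (hp : p ∈ S) (hq : q ∈ S) {δ : ℝ}
    (hδ : δ ≤ 1 / 2) (hL : 0 < lfs S p) (hpq : dist p q ≤ δ * lfs S p) :
    AngleLE (tangentDir S q)ᗮ (tangentDir S p)ᗮ (eta d k δ) := by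
  set L := lfs S p with hLdef
  have h := hS.unitFeature hSc hp hL le_rfl
  set q' := L⁻¹ • (q - p) with hq'
  have hq'S : q' ∈ (fun w => L⁻¹ • (w - p)) '' S := ⟨q, hq, rfl⟩
  have hqe : p + L • q' = q := by rw [hq', smul_inv_smul₀ hL.ne', add_sub_cancel]
  have hqδ : ‖q'‖ ≤ δ := by
    rw [hq', norm_smul, norm_inv, Real.norm_of_nonneg hL.le, inv_mul_eq_div, div_le_iff₀ hL,
      ← dist_eq_norm, dist_comm]
    exact hpq
  have hq2 := hqδ.trans hδ
  have hfin := hS.finrank_normal hp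
  have hbot : (tangentDir S p)ᗮ ≠ ⊥ := fun hb => by
    rw [hb, finrank_bot] at hfin; omega
  have hsq : ‖q'‖ ^ 2 ≤ δ ^ 2 := by gcongr
  have hδ2 : δ ^ 2 ≤ 1 / 4 := by nlinarith [norm_nonneg q']
  have hs : 0 < √(1 - δ ^ 2) := Real.sqrt_pos.2 (by linarith)
  have hss : √(1 - δ ^ 2) ≤ √(1 - ‖q'‖ ^ 2) := Real.sqrt_le_sqrt (by linarith)
  have hn : ∀ n ∈ (tangentDir S q)ᗮ, n ∈ (tangentDir S (p + L • q'))ᗮ := fun n hn => by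
    rwa [hqe]
  unfold eta
  split_ifs with hd
  · refine angleLE_arccos hbot fun n hnq hn1 => ?_
    have h1 := h.norm_normal_part_ge_of_finrank_eq_one hq'S hq2 (hn n hnq) hn1
      (by rw [smul_zero, add_zero]; omega)
    simp only [smul_zero, add_zero] at h1
    refine le_trans ?_ h1
    gcongr
  · refine angleLE_arccos hbot fun n hnq hn1 => ?_
    have h1 := h.norm_normal_part_sq_ge hq'S hq2 (hn n hnq) hn1
    simp only [smul_zero, add_zero] at h1
    refine Real.sqrt_le_iff.2 ⟨norm_nonneg _, le_trans ?_ h1⟩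
    gcongr

end NormalVariation

end SurfApprox

namespace SurfApprox

open Filter Topology InnerProductGeometry EuclideanGeometry

/-! ### Plane geometry of the triangle -/

section Triangle

variable {E : Type*} [NormedAddCommGroup E] [InnerProductSpace ℝ E]

theorem norm_sq_mul_gram {a b g : E} (hg : g ∈ Submodule.span ℝ {a, b}) :
    ‖g‖ ^ 2 * (‖a‖ ^ 2 * ‖b‖ ^ 2 - inner ℝ a b ^ 2) =
      inner ℝ g a ^ 2 * ‖b‖ ^ 2 + inner ℝ g b ^ 2 * ‖a‖ ^ 2 -
        2 * inner ℝ g a * inner ℝ g b * inner ℝ a b := by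
  obtain ⟨α, β, rfl⟩ := Submodule.mem_span_pair.1 hg
  simp only [← real_inner_self_eq_norm_sq, inner_add_left, inner_add_right, real_inner_smul_left,
    real_inner_smul_right, real_inner_comm a b]
  ring

/-- `A`, `B`, `D` are the squared edge lengths and the inner product of the edges, `G` the squared
circumradius, `x` the squared planar part of the normal. The worst signs of `X`, `Y` make `x L² / G`
at most `(A + B + 2|D|) / (A + B - 2D)`, which is at most `T`. -/
theorem triangle_arith {A B D C T R L x G : ℝ} (hA : 0 ≤ A) (hB : 0 ≤ B) (hL : 0 < L)
    (hΔ : D ^ 2 < A * B) (hC0 : 0 ≤ C) (hC1 : C < 1) (hD : D ≤ C * ((A + B) / 2))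
    (hT : T * (1 - C) = 1 + C) {X Y : ℝ} (hX : |X| ≤ A / (2 * L)) (hY : |Y| ≤ B / (2 * L))
    (hx : x * (A * B - D ^ 2) = X ^ 2 * B + Y ^ 2 * A - 2 * X * Y * D)
    (hG : G * (A * B - D ^ 2) = (A / 2) ^ 2 * B + (B / 2) ^ 2 * A - 2 * (A / 2) * (B / 2) * D)
    (hGR : G ≤ R ^ 2) : x ≤ (R / L) ^ 2 * T := by
  have hΔ' : 0 < A * B - D ^ 2 := by linarith
  have h1 : x * (A * B - D ^ 2) ≤ A * B * (A + B + 2 * |D|) / (4 * L ^ 2) := by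
    rw [hx]
    have hX2 : X ^ 2 ≤ (A / (2 * L)) ^ 2 := sq_le_sq' (abs_le.1 hX).1 (abs_le.1 hX).2
    have hY2 : Y ^ 2 ≤ (B / (2 * L)) ^ 2 := sq_le_sq' (abs_le.1 hY).1 (abs_le.1 hY).2
    have hXYD : -(X * Y * D) ≤ A / (2 * L) * (B / (2 * L)) * |D| := by
      refine (neg_le_abs _).trans ?_
      rw [abs_mul, abs_mul]
      gcongr
    have e : A * B * (A + B + 2 * |D|) / (4 * L ^ 2) = (A / (2 * L)) ^ 2 * B +
        (B / (2 * L)) ^ 2 * A + 2 * (A / (2 * L) * (B / (2 * L)) * |D|) := by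
      field_simp
      ring
    rw [e]
    have := mul_le_mul_of_nonneg_right hX2 hB
    have := mul_le_mul_of_nonneg_right hY2 hA
    linarith
  have h2 : A + B + 2 * |D| ≤ T * (A + B - 2 * D) := by
    have hT' : T = (1 + C) / (1 - C) := by rw [eq_div_iff (by linarith)]; exact hT
    have hT1 : 1 ≤ T := by rw [hT', le_div_iff₀ (by linarith)]; linarith
    rcases le_total D 0 with h | h
    · rw [abs_of_nonpos h]
      nlinarith
    · rw [abs_of_nonneg h, hT', div_mul_eq_mul_div, le_div_iff₀ (by linarith)]
      nlinarith
  have h3 : A * B * (A + B - 2 * D) ≤ 4 * (R ^ 2 * (A * B - D ^ 2)) := by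
    have := mul_le_mul_of_nonneg_right hGR hΔ'.le
    rw [hG] at this
    linarith
  have hT0 : 0 ≤ T := by
    have hT' : T = (1 + C) / (1 - C) := by rw [eq_div_iff (by linarith)]; exact hT
    rw [hT']; exact div_nonneg (by linarith) (by linarith)
  refine le_of_mul_le_mul_right (h1.trans ?_) hΔ'
  rw [div_le_iff₀ (by positivity)]
  calc A * B * (A + B + 2 * |D|) ≤ A * B * (T * (A + B - 2 * D)) := by gcongr
    _ = T * (A * B * (A + B - 2 * D)) := by ring
    _ ≤ T * (4 * (R ^ 2 * (A * B - D ^ 2))) := by gcongr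
    _ = (R / L) ^ 2 * T * (A * B - D ^ 2) * (4 * L ^ 2) := by field_simp

/-- A vector that makes small inner products with two edge vectors of a triangle is almost normal
to the triangle. -/
theorem norm_starProjection_span_pair_le [FiniteDimensional ℝ E] {a b n u : E} {C t R L : ℝ} (hL : 0 < L) (hR : 0 ≤ R)
    (hΔ : inner ℝ a b ^ 2 < ‖a‖ ^ 2 * ‖b‖ ^ 2) (hC0 : 0 ≤ C) (hC1 : C < 1)
    (hD : inner ℝ a b ≤ C * (‖a‖ * ‖b‖)) (ht : 0 ≤ t) (hT : t ^ 2 * (1 - C) = 1 + C)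
    (hna : |inner ℝ n a| ≤ ‖a‖ ^ 2 / (2 * L)) (hnb : |inner ℝ n b| ≤ ‖b‖ ^ 2 / (2 * L))
    (hua : inner ℝ u a = ‖a‖ ^ 2 / 2) (hub : inner ℝ u b = ‖b‖ ^ 2 / 2) (hu : ‖u‖ = R) :
    ‖(Submodule.span ℝ {a, b}).starProjection n‖ ≤ R / L * t := by
  set K := Submodule.span ℝ {a, b} with hK
  have haK : a ∈ K := Submodule.subset_span (by simp)
  have hbK : b ∈ K := Submodule.subset_span (by simp)
  have hin : ∀ z, ∀ c ∈ K, inner ℝ (K.starProjection z) c = inner ℝ z c := fun z c hc => by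
    rw [Submodule.inner_starProjection_left_eq_right, Submodule.starProjection_eq_self_iff.2 hc]
  have h1 := norm_sq_mul_gram (Submodule.starProjection_apply_mem K n)
  have h2 := norm_sq_mul_gram (Submodule.starProjection_apply_mem K u)
  rw [hin _ _ haK, hin _ _ hbK] at h1 h2
  rw [hua, hub] at h2
  have h3 : ‖K.starProjection u‖ ^ 2 ≤ R ^ 2 := by
    rw [← hu, norm_sq_eq_starProjection K u]
    linarith [sq_nonneg ‖Kᗮ.starProjection u‖]
  have hD' : inner ℝ a b ≤ C * ((‖a‖ ^ 2 + ‖b‖ ^ 2) / 2) := by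
    refine hD.trans ?_
    gcongr
    nlinarith [sq_nonneg (‖a‖ - ‖b‖)]
  have h4 := triangle_arith (sq_nonneg _) (sq_nonneg _) hL hΔ hC0 hC1 hD' hT hna hnb h1 h2 h3
  refine le_of_sq_le_sq (h4.trans_eq ?_) (by positivity)
  ring

theorem direction_simplexNormal [DecidableEq E] {v₀ v₁ v₂ u : E} {R : ℝ} (h₀ : dist u v₀ = R)
    (h₁ : dist u v₁ = R) (h₂ : dist u v₂ = R) :
    (simplexNormal {v₀, v₁, v₂}).direction = (Submodule.span ℝ {v₁ - v₀, v₂ - v₀})ᗮ := by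
  have hmem : ∀ z : E, z ∈ simplexNormal {v₀, v₁, v₂} ↔ dist z v₀ = dist z v₁ ∧
      dist z v₀ = dist z v₂ := by
    intro z
    simp only [simplexNormal, AffineSubspace.mem_iInf_iff, Finset.mem_insert,
      Finset.mem_singleton, AffineSubspace.mem_perpBisector_iff_dist_eq]
    constructor
    · intro h
      exact ⟨h _ (by simp) _ (by simp), h _ (by simp) _ (by simp)⟩
    · rintro ⟨h1, h2⟩ v (rfl | rfl | rfl) w (rfl | rfl | rfl) <;> simp_all
  have hu : u ∈ simplexNormal {v₀, v₁, v₂} := (hmem u).2 ⟨by rw [h₀, h₁], by rw [h₀, h₂]⟩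
  ext z
  rw [← AffineSubspace.vadd_mem_iff_mem_direction z hu, hmem, vadd_eq_add]
  have key : ∀ v, dist u v = R → (dist (z + u) v₀ = dist (z + u) v ↔ inner ℝ (v - v₀) z = 0) := by
    intro v hv
    rw [← sq_eq_sq₀ dist_nonneg dist_nonneg, dist_eq_norm, dist_eq_norm, add_sub_assoc,
      add_sub_assoc, norm_add_sq_real, norm_add_sq_real, ← dist_eq_norm, ← dist_eq_norm, h₀, hv]
    rw [show v - v₀ = (u - v₀) - (u - v) by abel, inner_sub_left, real_inner_comm z (u - v₀),
      real_inner_comm z (u - v)]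
    constructor <;> intro h <;> linarith
  rw [key v₁ h₁, key v₂ h₂, Submodule.mem_orthogonal]
  constructor
  · rintro ⟨h1, h2⟩ w hw
    obtain ⟨α, β, rfl⟩ := Submodule.mem_span_pair.1 hw
    rw [inner_add_left, real_inner_smul_left, real_inner_smul_left, h1, h2, mul_zero, mul_zero,
      add_zero]
  · intro h
    exact ⟨h _ (Submodule.subset_span (by simp)), h _ (Submodule.subset_span (by simp))⟩

theorem finrank_span_pair_le (a b : E) : Module.finrank ℝ (Submodule.span ℝ {a, b}) ≤ 2 := by
  classical
  refine (finrank_span_le_card ({a, b} : Set E)).trans ?_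
  rw [Set.toFinset_insert, Set.toFinset_singleton]
  exact Finset.card_le_two

theorem not_collinear_of_affineIndependent [DecidableEq E] {v₀ v₁ v₂ : E}
    (hc : ({v₀, v₁, v₂} : Finset E).card = 3)
    (h : AffineIndependent ℝ (fun v : ({v₀, v₁, v₂} : Finset E) => (v : E))) :
    ¬ Collinear ℝ {v₀, v₁, v₂} := by
  intro hcol
  have h1 := h.finrank_vectorSpan (n := 2) (by simpa using hc)
  have h2 : Set.range (fun v : ({v₀, v₁, v₂} : Finset E) => (v : E)) = {v₀, v₁, v₂} := by
    ext; simp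
  rw [h2] at h1
  have : FiniteDimensional ℝ (vectorSpan ℝ ({v₀, v₁, v₂} : Set E)) :=
    finiteDimensional_vectorSpan_of_finite ℝ (Set.toFinite _)
  have h3 := collinear_iff_finrank_le_one.1 hcol
  omega

theorem cot_half_sq_mul {ψ : ℝ} (h : Real.sin (ψ / 2) ≠ 0) :
    Real.cot (ψ / 2) ^ 2 * (1 - Real.cos ψ) = 1 + Real.cos ψ := by
  have h1 : Real.cos ψ = 2 * Real.cos (ψ / 2) ^ 2 - 1 := by
    rw [← Real.cos_two_mul]; congr 1; ring
  have h2 := Real.sin_sq_add_cos_sq (ψ / 2)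
  rw [Real.cot_eq_cos_div_sin, h1, div_pow, show (1 - (2 * Real.cos (ψ / 2) ^ 2 - 1)) =
    2 * Real.sin (ψ / 2) ^ 2 by linarith]
  field_simp
  ring

theorem cot_half_nonneg {ψ : ℝ} (h0 : 0 ≤ ψ) (h1 : ψ ≤ Real.pi) : 0 ≤ Real.cot (ψ / 2) := by
  rw [Real.cot_eq_cos_div_sin]
  exact div_nonneg (Real.cos_nonneg_of_mem_Icc ⟨by linarith, by linarith⟩)
    (Real.sin_nonneg_of_nonneg_of_le_pi (by linarith) (by linarith))

end Triangle

/-! ### The triangle normal lemma -/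

section TriangleNormal

variable {d k : ℕ} {S : Set (EuclideanSpace ℝ (Fin d))}

/-- `w` is outside the balls of radius `lfs S p` tangent at `p` in the directions `n` and `-n`. -/
theorem IsSubmanifold.abs_inner_normal_le (hS : IsSubmanifold k S) (hSc : IsCompact S)
    {p w n : EuclideanSpace ℝ (Fin d)} (hp : p ∈ S) (hw : w ∈ S) (hL : 0 < lfs S p)
    (hn : n ∈ (tangentDir S p)ᗮ) (hn1 : ‖n‖ = 1) :
    |inner ℝ n (w - p)| ≤ ‖w - p‖ ^ 2 / (2 * lfs S p) := by
  suffices h : ∀ n ∈ (tangentDir S p)ᗮ, ‖n‖ = 1 →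
      inner ℝ n (w - p) ≤ ‖w - p‖ ^ 2 / (2 * lfs S p) by
    refine abs_le.2 ⟨?_, h n hn hn1⟩
    have := h (-n) (Submodule.neg_mem _ hn) (by rwa [norm_neg])
    rw [inner_neg_left] at this
    linarith
  intro n hn hn1
  have h1 := hS.empty_ball hSc hp hn hn1 hL.le (fun s hs0 hs =>
    notMem_medialAxis_of_dist_lt_lfs (p := p) (by
      rwa [dist_self_add_right, norm_smul, hn1, mul_one, Real.norm_of_nonneg hs0.le])) w hw
  have h2 : lfs S p ^ 2 ≤ dist (p + lfs S p • n) w ^ 2 := by gcongr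
  rw [dist_eq_norm, show p + lfs S p • n - w = lfs S p • n - (w - p) by abel, norm_sub_sq_real,
    real_inner_smul_left, norm_smul, hn1, mul_one, Real.norm_of_nonneg hL.le] at h2
  rw [le_div_iff₀ (by positivity)]
  linarith

/-- The triangle normal lemma: the normal space at a vertex of a triangle is close to the normal
space of the triangle. -/
theorem IsSubmanifold.angleLE_simplexNormal (hS : IsSubmanifold k S) (hSc : IsCompact S)
    [DecidableEq (EuclideanSpace ℝ (Fin d))] (hk : 2 ≤ k) (hkd : k < d) {v₀ v₁ v₂ u : EuclideanSpace ℝ (Fin d)}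
    (hv₀ : v₀ ∈ S) (hv₁ : v₁ ∈ S) (hv₂ : v₂ ∈ S) {R δ ψ : ℝ}
    (h₀ : dist u v₀ = R) (h₁ : dist u v₁ = R) (h₂ : dist u v₂ = R)
    (hcol : ¬ Collinear ℝ {v₀, v₁, v₂}) (hL : 0 < lfs S v₀) (hR : R ≤ δ * lfs S v₀)
    (hψ0 : 0 < ψ) (hψ : ψ ≤ Real.pi / 2) (hcos : Real.cos (∠ v₁ v₀ v₂) ≤ Real.cos ψ) :
    AngleLE (tangentDir S v₀)ᗮ (simplexNormal {v₀, v₁, v₂}).direction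
      (Real.arcsin (δ * Real.cot (ψ / 2))) := by
  rw [direction_simplexNormal h₀ h₁ h₂]
  set a := v₁ - v₀ with ha
  set b := v₂ - v₀ with hb
  set K := Submodule.span ℝ {a, b} with hK
  have hpi := Real.pi_pos
  have hR0 : 0 ≤ R := h₀ ▸ dist_nonneg
  have hRL : R / lfs S v₀ ≤ δ := by rwa [div_le_iff₀ hL]
  have hδ : 0 ≤ δ := (div_nonneg hR0 hL.le).trans hRL
  have ht : 0 ≤ Real.cot (ψ / 2) := cot_half_nonneg hψ0.le (by linarith)
  have hsin : Real.sin (ψ / 2) ≠ 0 :=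
    (Real.sin_pos_of_pos_of_lt_pi (by linarith) (by linarith)).ne'
  have hC0 : 0 ≤ Real.cos ψ := Real.cos_nonneg_of_mem_Icc ⟨by linarith, hψ⟩
  have hC1 : Real.cos ψ < 1 := by
    rw [← Real.cos_zero]
    exact Real.cos_lt_cos_of_nonneg_of_le_pi le_rfl (by linarith) hψ0
  have hinner : inner ℝ a b = Real.cos (∠ v₁ v₀ v₂) * (‖a‖ * ‖b‖) :=
    (cos_angle_mul_norm_mul_norm a b).symm
  have hcol' : ¬ Collinear ℝ {v₁, v₀, v₂} := by rwa [Set.insert_comm]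
  have hsin2 : 0 < Real.sin (∠ v₁ v₀ v₂) := sin_pos_of_not_collinear hcol'
  have ha0 : 0 < ‖a‖ := norm_pos_iff.2 (sub_ne_zero.2 (ne₁₂_of_not_collinear hcol'))
  have hb0 : 0 < ‖b‖ := norm_pos_iff.2 (sub_ne_zero.2 (ne₂₃_of_not_collinear hcol').symm)
  have hΔ : inner ℝ a b ^ 2 < ‖a‖ ^ 2 * ‖b‖ ^ 2 := by
    rw [hinner, mul_pow, mul_pow]
    refine mul_lt_of_lt_one_left (by positivity) ?_
    nlinarith [Real.sin_sq_add_cos_sq (∠ v₁ v₀ v₂)]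
  have hua : ∀ v, dist u v = R → inner ℝ (u - v₀) (v - v₀) = ‖v - v₀‖ ^ 2 / 2 := by
    intro v hv
    have h1 : ‖u - v₀ - (v - v₀)‖ ^ 2 = ‖u - v₀‖ ^ 2 := by
      rw [sub_sub_sub_cancel_right, ← dist_eq_norm, ← dist_eq_norm, h₀, hv]
    rw [norm_sub_sq_real] at h1
    linarith
  have hbot : Kᗮ ≠ ⊥ := fun h => by
    have h1 := K.finrank_add_finrank_orthogonal
    have h2 : Module.finrank ℝ K ≤ 2 := finrank_span_pair_le a b
    rw [h, finrank_bot, finrank_euclideanSpace_fin] at h1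
    omega
  rw [Real.arcsin_eq_arccos (by positivity)]
  refine angleLE_arccos hbot fun n hn hn1 => ?_
  have h1 := norm_starProjection_span_pair_le hL hR0 hΔ hC0 hC1
    (by rw [hinner]; gcongr) ht (cot_half_sq_mul hsin)
    (hS.abs_inner_normal_le hSc hv₀ hv₁ hL hn hn1) (hS.abs_inner_normal_le hSc hv₀ hv₂ hL hn hn1)
    (hua v₁ h₁) (hua v₂ h₂) (by rw [← dist_eq_norm]; exact h₀)
  have h2 : ‖K.starProjection n‖ ≤ δ * Real.cot (ψ / 2) := h1.trans (by gcongr)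
  have h3 := norm_sq_eq_starProjection K n
  have h4 : ‖K.starProjection n‖ ^ 2 ≤ (δ * Real.cot (ψ / 2)) ^ 2 := by gcongr
  rw [hn1] at h3
  exact Real.sqrt_le_iff.2 ⟨norm_nonneg _, by linarith⟩

end TriangleNormal

end SurfApprox

namespace SurfApprox

open Filter Topology InnerProductGeometry EuclideanGeometry

/-! ### Power comparisons and distance bounds -/

section Spheres

variable {E : Type*} [NormedAddCommGroup E] [InnerProductSpace ℝ E]

/-- On the convex hull of points of the ball `B(u, R)` outside the ball `B(m, r)`, the power with
respect to the first ball is at most the power with respect to the second. -/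
theorem power_le_of_mem_convexHull {s : Set E} {u m x : E} {R r : ℝ} (hr : 0 ≤ r)
    (hu : ∀ v ∈ s, dist u v ≤ R) (hm : ∀ v ∈ s, r ≤ dist m v) (hx : x ∈ convexHull ℝ s) :
    dist x u ^ 2 - R ^ 2 ≤ dist x m ^ 2 - r ^ 2 := by
  have key : ∀ z : E, dist z u ^ 2 - R ^ 2 ≤ dist z m ^ 2 - r ^ 2 ↔
      inner ℝ (m - u) z ≤ (‖m‖ ^ 2 - r ^ 2 - ‖u‖ ^ 2 + R ^ 2) / 2 := by
    intro z
    rw [dist_eq_norm, dist_eq_norm, norm_sub_sq_real, norm_sub_sq_real, inner_sub_left,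
      real_inner_comm z m, real_inner_comm z u]
    constructor <;> intro h <;> linarith
  have hconv : Convex ℝ {z : E | inner ℝ (m - u) z ≤ (‖m‖ ^ 2 - r ^ 2 - ‖u‖ ^ 2 + R ^ 2) / 2} :=
    convex_halfSpace_le (innerₗ E (m - u)).isLinear _
  refine (key x).2 (convexHull_min (fun v hv => (key v).1 ?_) hconv hx)
  have h1 : dist v u ^ 2 ≤ R ^ 2 := by
    have := hu v hv
    rw [dist_comm] at this
    gcongr
  have h2 : r ^ 2 ≤ dist v m ^ 2 := by
    have := hm v hv
    rw [dist_comm] at this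
    gcongr
  linarith

theorem dist_lt_of_mem_convexHull {s : Set E} {u y x : E}
    (h : ∀ v ∈ s, dist u v < dist y v) (hx : x ∈ convexHull ℝ s) : dist x u < dist x y := by
  have key : ∀ z : E, dist z u < dist z y ↔ inner ℝ (y - u) z < (‖y‖ ^ 2 - ‖u‖ ^ 2) / 2 := by
    intro z
    rw [← sq_lt_sq₀ dist_nonneg dist_nonneg, dist_eq_norm, dist_eq_norm, norm_sub_sq_real,
      norm_sub_sq_real, inner_sub_left, real_inner_comm z y, real_inner_comm z u]
    constructor <;> intro h <;> linarith
  have hconv : Convex ℝ {z : E | inner ℝ (y - u) z < (‖y‖ ^ 2 - ‖u‖ ^ 2) / 2} :=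
    convex_halfSpace_lt (innerₗ E (y - u)).isLinear _
  refine (key x).2 (convexHull_min (fun v hv => (key v).1 ?_) hconv hx)
  rw [dist_comm v u, dist_comm v y]
  exact h v hv

/-- The vertex set `s` lies on a sphere of radius `R` about a point `u` of `S`, where `R` is smaller
than the local feature size of `u`, and `x` is in the convex hull of `s`. -/
structure SmallSphere (S : Set E) (s : Set E) (u : E) (R : ℝ) (x : E) : Prop where
  isCompact : IsCompact S
  subset : s ⊆ S
  mem : u ∈ S
  dist_eq : ∀ v ∈ s, dist u v = R
  lt_lfs : R < lfs S u
  radius_pos : 0 < R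
  mem_convexHull : x ∈ convexHull ℝ s

namespace SmallSphere

variable {S s : Set E} {u x y : E} {R : ℝ}

theorem dist_center_le (h : SmallSphere S s u R x) : dist x u ≤ R := by
  have : s ⊆ Metric.closedBall u R := fun v hv => by
    rw [Metric.mem_closedBall, dist_comm, h.dist_eq v hv]
  exact convexHull_min this (convex_closedBall u R) h.mem_convexHull

theorem existsUnique_isNearestPoint (h : SmallSphere S s u R x) :
    ∃! y, IsNearestPoint S x y := by
  obtain ⟨y, hy⟩ := exists_isNearestPoint h.isCompact ⟨u, h.mem⟩ x
  refine ⟨y, hy, fun z hz => hz.eq_of_notMem_medialAxis ?_ hy⟩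
  refine notMem_medialAxis_of_dist_lt_lfs (p := u) ?_
  rw [dist_comm]
  exact h.dist_center_le.trans_lt h.lt_lfs

theorem dist_nearest_le (h : SmallSphere S s u R x) (hy : IsNearestPoint S x y) :
    dist x y ≤ R :=
  (hy.2 u h.mem).trans h.dist_center_le

/-- Otherwise all vertices, and with them `x`, would be strictly closer to `u` than to `y`. -/
theorem exists_vertex_dist_le (h : SmallSphere S s u R x) (hy : IsNearestPoint S x y) :
    ∃ v ∈ s, dist y v ≤ R := by
  by_contra! hcon
  exact absurd (hy.2 u h.mem) (not_le.2 (dist_lt_of_mem_convexHull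
    (fun v hv => by rw [h.dist_eq v hv]; exact hcon v hv) h.mem_convexHull))

/-- The empty ball tangent to `S` at the nearest point of `x`, grown in the direction of `x` until
its center is at distance `lfs S u` from `u`. -/
theorem exists_large_empty_ball [ProperSpace E] (h : SmallSphere S s u R x)
    (hy : IsNearestPoint S x y) (hxy : x ≠ y) :
    ∃ n : E, ‖n‖ = 1 ∧ y + dist x y • n = x ∧ ∃ r, dist x y < r ∧
      dist (y + r • n) u = lfs S u ∧ ∀ w ∈ S, r ≤ dist (y + r • n) w := by
  have hd : 0 < dist x y := dist_pos.2 hxy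
  set t := dist x y with ht
  set n : E := t⁻¹ • (x - y) with hn
  have hn1 : ‖n‖ = 1 := by
    rw [hn, norm_smul, ← dist_eq_norm, norm_inv, Real.norm_of_nonneg hd.le, inv_mul_cancel₀ hd.ne']
  have hx : y + t • n = x := by rw [hn, smul_inv_smul₀ hd.ne']; abel
  refine ⟨n, hn1, hx, ?_⟩
  set L := lfs S u with hL
  have hRL := h.lt_lfs
  have hxu := h.dist_center_le
  have hcont : Continuous fun r : ℝ => dist (y + r • n) u := by fun_prop
  have hbig : L ≤ dist (y + (t + 2 * L) • n) u := by
    have h1 : dist (y + (t + 2 * L) • n) (y + t • n) = 2 * L := by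
      rw [dist_add_left, dist_eq_norm, ← sub_smul, norm_smul, hn1, add_sub_cancel_left, mul_one,
        Real.norm_of_nonneg (by linarith [h.radius_pos])]
    rw [hx] at h1
    have h2 := dist_triangle (y + (t + 2 * L) • n) u x
    rw [dist_comm u x] at h2
    linarith
  -- At parameter `t` the centre is `x`, closer than `L` to `u`; by `t + 2 * L` it is at least `L`
  -- away.
  obtain ⟨r, hr, hrL⟩ := intermediate_value_Icc (by linarith [h.radius_pos] : t ≤ t + 2 * L)
    hcont.continuousOn ⟨by simp only [hx]; linarith, hbig⟩
  have htr : t < r := by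
    refine lt_of_le_of_ne hr.1 ?_
    rintro rfl
    simp only [hx] at hrL
    linarith
  refine ⟨r, htr, hrL, empty_ball_extension h.isCompact hy.1 hn1 hd htr.le
    (fun w hw => by rw [hx]; exact hy.2 w hw) fun a ha1 ha2 => ?_⟩
  refine notMem_medialAxis_of_dist_lt_lfs (p := u) ?_
  rw [dist_comm]
  have hden : 0 < r - t := by linarith
  have heq : y + a • n - u = ((r - a) / (r - t)) • (y + t • n - u) +
      ((a - t) / (r - t)) • (y + r • n - u) := by
    have h1 : (r - a) / (r - t) + (a - t) / (r - t) = 1 := by field_simp; ring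
    have h2 : (r - a) / (r - t) * t + (a - t) / (r - t) * r = a := by field_simp; ring
    calc y + a • n - u = ((r - a) / (r - t) + (a - t) / (r - t)) • (y - u) +
          ((r - a) / (r - t) * t + (a - t) / (r - t) * r) • n := by
          rw [h1, h2, one_smul]; abel
      _ = _ := by module
  have h1 : 0 < (r - a) / (r - t) := div_pos (by linarith) hden
  have h2 : 0 ≤ (a - t) / (r - t) := div_nonneg (by linarith) hden.le
  have h3 : (r - a) / (r - t) + (a - t) / (r - t) = 1 := by field_simp; ring
  rw [dist_eq_norm, heq]
  refine (norm_add_le _ _).trans_lt ?_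
  rw [norm_smul, norm_smul, Real.norm_of_nonneg h1.le, Real.norm_of_nonneg h2, ← dist_eq_norm,
    ← dist_eq_norm, hx]
  simp only at hrL
  rw [hrL]
  have h4 : (r - a) / (r - t) * dist x u < (r - a) / (r - t) * L := by
    have : dist x u < L := hxu.trans_lt hRL
    gcongr
  calc _ < (r - a) / (r - t) * L + (a - t) / (r - t) * L := by linarith
    _ = L := by rw [← add_mul, h3, one_mul]

theorem dist_add_smul_nearest {n : E} (hn : ‖n‖ = 1) (hx : y + dist x y • n = x) {r : ℝ}
    (hr : dist x y ≤ r) : dist x (y + r • n) = r - dist x y := by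
  nth_rw 1 [← hx]
  rw [dist_add_left, dist_comm, dist_eq_norm, ← sub_smul, norm_smul, hn, mul_one,
    Real.norm_of_nonneg (sub_nonneg.2 hr)]

/-- Write `L = lfs S u`, `t = dist x y`. The power comparison and `0 ≤ L - (r - t) ≤ dist x u`
combine to `(L - r)² + 2Lt ≤ R²`. -/
theorem dist_nearest_le_sq [ProperSpace E] (h : SmallSphere S s u R x)
    (hy : IsNearestPoint S x y) : dist x y ≤ R ^ 2 / (2 * lfs S u) := by
  have hL : 0 < lfs S u := h.radius_pos.trans h.lt_lfs
  rcases eq_or_ne x y with rfl | hxy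
  · rw [dist_self]; positivity
  obtain ⟨n, hn1, hx, r, hr, hrL, hempty⟩ := h.exists_large_empty_ball hy hxy
  have ht : 0 < dist x y := dist_pos.2 hxy
  have h1 := power_le_of_mem_convexHull (by linarith) (fun v hv => (h.dist_eq v hv).le)
    (fun v hv => hempty v (h.subset hv)) h.mem_convexHull
  have h2 := hempty u h.mem
  have h3 := dist_triangle_left (y + r • n) u x
  rw [dist_add_smul_nearest hn1 hx hr.le] at h1 h3
  rw [hrL] at h2 h3
  have h4 : (lfs S u - (r - dist x y)) ^ 2 ≤ dist x u ^ 2 := by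
    have : lfs S u - (r - dist x y) ≤ dist x u := by linarith
    have : 0 ≤ lfs S u - (r - dist x y) := by linarith
    gcongr
  rw [le_div_iff₀ (by positivity)]
  nlinarith [sq_nonneg (lfs S u - r)]

/-- Expand the squared distance to `u` along the normal ray at `x` and at the large ball's centre,
and eliminate the inner product `D`; `R ≤ lfs S u` leaves `(r - t) |yu|² ≤ (r - t) R²`. -/
theorem dist_nearest_center_le [ProperSpace E] (h : SmallSphere S s u R x)
    (hy : IsNearestPoint S x y) : dist y u ≤ R := by
  rcases eq_or_ne x y with rfl | hxy
  · exact h.dist_center_le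
  obtain ⟨n, hn1, hx, r, hr, hrL, hempty⟩ := h.exists_large_empty_ball hy hxy
  have ht : 0 < dist x y := dist_pos.2 hxy
  have h1 := power_le_of_mem_convexHull (by linarith) (fun v hv => (h.dist_eq v hv).le)
    (fun v hv => hempty v (h.subset hv)) h.mem_convexHull
  rw [dist_add_smul_nearest hn1 hx hr.le] at h1
  have hexp : ∀ a : ℝ, dist (y + a • n) u ^ 2 = dist y u ^ 2 + 2 * (a * inner ℝ (y - u) n) +
      a ^ 2 := by
    intro a
    rw [dist_eq_norm, dist_eq_norm, show y + a • n - u = y - u + a • n by abel, norm_add_sq_real,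
      real_inner_smul_right, norm_smul, hn1, mul_one, Real.norm_eq_abs, sq_abs]
  have h2 := hexp r
  have h3 := hexp (dist x y)
  rw [hrL] at h2
  rw [hx] at h3
  set D : ℝ := inner ℝ (y - u) n
  set t := dist x y
  have h4 : R ^ 2 ≤ lfs S u ^ 2 := by
    have := h.lt_lfs
    have := h.radius_pos
    gcongr
  have h5 : dist y u ^ 2 ≤ R ^ 2 - 2 * (t * D) - 2 * r * t := by linarith
  have h6 : r * dist y u ^ 2 ≤ r * (R ^ 2 - 2 * (t * D) - 2 * r * t) :=
    mul_le_mul_of_nonneg_left h5 (by linarith)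
  have h7 : t * (2 * (r * D)) = t * (lfs S u ^ 2 - dist y u ^ 2 - r ^ 2) := by
    rw [h2]; ring
  have h8 : (r - t) * dist y u ^ 2 ≤ (r - t) * R ^ 2 := by
    have := mul_le_mul_of_nonneg_left h4 ht.le
    have : 0 ≤ t * r ^ 2 := by positivity
    linarith
  exact le_of_sq_le_sq (le_of_mul_le_mul_left h8 (by linarith)) h.radius_pos.le

theorem dist_nearest_le_lfs [ProperSpace E] (h : SmallSphere S s u R x)
    (hy : IsNearestPoint S x y) {δ : ℝ} (hδ : δ < 1) (hR : R ≤ δ * lfs S y) :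
    dist x y ≤ (1 - √(1 - δ ^ 2)) * lfs S y := by
  have hR0 := h.radius_pos
  have hr0 : 0 < lfs S y := by
    refine lt_of_le_of_ne (lfs_nonneg S y) fun h0 => ?_
    rw [← h0] at hR; linarith
  have hδ0 : 0 < δ := by
    by_contra! hneg
    nlinarith
  rcases eq_or_ne x y with rfl | hxy
  · rw [dist_self]
    have : √(1 - δ ^ 2) ≤ 1 := Real.sqrt_le_one.2 (by nlinarith)
    exact mul_nonneg (by linarith) hr0.le
  obtain ⟨n, hn1, hx, -⟩ := h.exists_large_empty_ball hy hxy
  have ht : 0 < dist x y := dist_pos.2 hxy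
  set r := lfs S y with hr
  have htr : dist x y < r := by
    have := h.dist_nearest_le hy
    nlinarith
  have hempty := empty_ball_extension h.isCompact hy.1 hn1 ht htr.le
    (fun w hw => by rw [hx]; exact hy.2 w hw) fun a ha1 ha2 =>
      notMem_medialAxis_of_dist_lt_lfs (p := y) (by
        rwa [dist_self_add_right, norm_smul, hn1, mul_one, Real.norm_of_nonneg (by linarith)])
  have h1 := power_le_of_mem_convexHull (by linarith) (fun v hv => (h.dist_eq v hv).le)
    (fun v hv => hempty v (h.subset hv)) h.mem_convexHull
  rw [dist_add_smul_nearest hn1 hx htr.le] at h1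
  have h2 : R ^ 2 ≤ (δ * r) ^ 2 := by gcongr
  have h3 : √(1 - δ ^ 2) * r ≤ r - dist x y := by
    refine le_of_sq_le_sq ?_ (by linarith)
    rw [mul_pow, Real.sq_sqrt (by nlinarith)]
    linarith [sq_nonneg (dist x u)]
  linarith

end SmallSphere

end Spheres

end SurfApprox

namespace SurfApprox

open Filter Topology InnerProductGeometry EuclideanGeometry

/-! ### Sampling bounds and the normal error -/

section Main

theorem IsRestrictedVoronoiVertex.exists_smallSphere {E : Type*} [NormedAddCommGroup E]
    [InnerProductSpace ℝ E] {S : Set E} (hSc : IsCompact S) {ε : ℝ} (hε : ε < 1 / 2)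
    {V : Finset E} (hV : IsEpsSample S ε V) {τ : Finset E} (hτV : τ ⊆ V) (hτ : τ.card = 3) {u : E}
    (hu : IsRestrictedVoronoiVertex S V τ u) {x : E} (hx : x ∈ convexHull ℝ (τ : Set E)) :
    0 < ε ∧ ∃ R, SmallSphere S τ u R x ∧ R ≤ ε * lfs S u := by
  obtain ⟨huV, huS⟩ := hu
  obtain ⟨a, ha⟩ : τ.Nonempty := Finset.card_pos.1 (by omega)
  have hcell : ∀ v ∈ τ, ∀ w ∈ V, dist u v ≤ dist u w := fun v hv w hw => huV v hv w hw
  have heq : ∀ v ∈ τ, dist u v = dist u a := fun v hv =>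
    le_antisymm (hcell v hv a (hτV ha)) (hcell a ha v (hτV hv))
  obtain ⟨w, hwV, hw⟩ := hV.2 u huS
  have hR : dist u a ≤ ε * lfs S u := (hcell a ha w hwV).trans hw
  -- Three distinct vertices cannot all equal `u`. This yields `lfs S u > 0`, excluding an empty
  -- medial axis, where `Metric.infDist` takes the value `0`.
  have hR0 : 0 < dist u a := by
    refine lt_of_le_of_ne dist_nonneg fun h0 => ?_
    have hsub : τ ⊆ {u} := fun v hv => by
      have := heq v hv
      rw [← h0, dist_eq_zero] at this
      rw [Finset.mem_singleton, this]
    have := Finset.card_le_card hsub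
    rw [Finset.card_singleton] at this
    omega
  have hε0 : 0 < ε := pos_of_mul_pos_left (hR0.trans_le hR) (lfs_nonneg S u)
  have hL : 0 < lfs S u := pos_of_mul_pos_right (hR0.trans_le hR) hε0.le
  refine ⟨hε0, dist u a, ⟨hSc, fun v hv => hV.1 (hτV hv), huS, heq, ?_, hR0, hx⟩, hR⟩
  nlinarith

theorem le_div_mul_lfs {E : Type*} [MetricSpace E] {S : Set E} {u y : E} {R ε : ℝ} (hε0 : 0 ≤ ε)
    (hε : ε < 1) (hR : R ≤ ε * lfs S u) (hy : dist u y ≤ R) : R ≤ ε / (1 - ε) * lfs S y := by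
  have h1 := lfs_le_lfs_add_dist S u y
  have h2 : (1 - ε) * lfs S u ≤ lfs S y := by linarith
  rw [div_mul_eq_mul_div, le_div_iff₀ (by linarith)]
  calc R * (1 - ε) ≤ ε * lfs S u * (1 - ε) := by
        have : 0 ≤ 1 - ε := by linarith
        gcongr
    _ = ε * ((1 - ε) * lfs S u) := by ring
    _ ≤ ε * lfs S y := by gcongr

theorem sq_div_two_le {ε : ℝ} (h0 : 0 ≤ ε) (hε : ε ≤ 1 / 2) :
    ε ^ 2 / 2 ≤ 1 - ε - √(1 - 2 * ε) := by
  have : √(1 - 2 * ε) ≤ 1 - ε - ε ^ 2 / 2 := by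
    refine Real.sqrt_le_iff.2 ⟨by nlinarith, ?_⟩
    have : 0 ≤ ε ^ 3 + ε ^ 4 / 4 := by positivity
    linarith
  linarith

theorem eta_nonneg (d k : ℕ) (δ : ℝ) : 0 ≤ eta d k δ := by
  unfold eta
  split_ifs
  exacts [Real.arccos_nonneg _, Real.arccos_nonneg _]

theorem normalErrorBound_nonneg (d k : ℕ) {ε φ : ℝ} (hε0 : 0 ≤ ε) (hε : ε ≤ 1) (hφ0 : 0 ≤ φ)
    (hφ : φ ≤ Real.pi) : 0 ≤ normalErrorBound d k ε φ :=
  le_max_of_le_left (add_nonneg (eta_nonneg _ _ _) (Real.arcsin_nonneg.2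
    (mul_nonneg (div_nonneg hε0 (by linarith)) (cot_half_nonneg hφ0 hφ))))

variable {d k : ℕ} {S : Set (EuclideanSpace ℝ (Fin d))}

theorem IsSubmanifold.angleLE_normalErrorBound [DecidableEq (EuclideanSpace ℝ (Fin d))]
    (hS : IsSubmanifold k S) (hk : 2 ≤ k) (hkd : k < d)
    {v₀ v₁ v₂ u x y : EuclideanSpace ℝ (Fin d)} {R ε φ : ℝ}
    (h : SmallSphere S (({v₀, v₁, v₂} : Finset (EuclideanSpace ℝ (Fin d))) : Set _) u R x)
    (hcol : ¬ Collinear ℝ {v₀, v₁, v₂}) (hε0 : 0 < ε) (hε : ε ≤ 1 / 3) (hR : R ≤ ε * lfs S u)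
    (hy : IsNearestPoint S x y) (hyv : dist y v₀ ≤ R) (hφ0 : 0 < φ) (hφ : φ ≤ Real.pi / 3) :
    AngleLE (tangentDir S y)ᗮ (simplexNormal {v₀, v₁, v₂}).direction
      (normalErrorBound d k ε φ) := by
  have hpi := Real.pi_pos
  have hSc := h.isCompact
  have hL : 0 < lfs S u := h.radius_pos.trans h.lt_lfs
  have hd₀ : dist u v₀ = R := h.dist_eq v₀ (by simp)
  have hd₁ : dist u v₁ = R := h.dist_eq v₁ (by simp)
  have hd₂ : dist u v₂ = R := h.dist_eq v₂ (by simp)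
  have hm₀ : v₀ ∈ S := h.subset (by simp)
  have hm₁ : v₁ ∈ S := h.subset (by simp)
  have hm₂ : v₂ ∈ S := h.subset (by simp)
  -- The role of `ε ≤ 1 / 3`: normal variation needs relative distance at most `1 / 2`.
  have hδ : ε / (1 - ε) ≤ 1 / 2 := by rw [div_le_iff₀ (by linarith)]; linarith
  have hRv : ∀ v, dist u v = R → R ≤ ε / (1 - ε) * lfs S v := fun v hv =>
    le_div_mul_lfs hε0.le (by linarith) hR hv.le
  have hLv : ∀ v, dist u v = R → 0 < lfs S v := fun v hv =>
    pos_of_mul_pos_right (h.radius_pos.trans_le (hRv v hv)) (div_nonneg hε0.le (by linarith))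
  rcases le_or_gt (Real.cos (∠ v₁ v₀ v₂)) (Real.cos φ) with hcos | hcos
  · refine AngleLE.mono ?_ (le_max_left _ _)
    exact (hS.angleLE_normal hSc hkd hm₀ hy.1 hδ (hLv v₀ hd₀)
      (by rw [dist_comm]; exact hyv.trans (hRv v₀ hd₀))).trans
      (hS.angleLE_simplexNormal hSc hk hkd hm₀ hm₁ hm₂ hd₀ hd₁ hd₂ hcol (hLv v₀ hd₀) (hRv v₀ hd₀)
        hφ0 (by linarith) hcos)
  · refine AngleLE.mono ?_ (le_max_right _ _)
    -- a vertex with an angle of at least `(π - φ) / 2`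
    have hyu : AngleLE (tangentDir S y)ᗮ (tangentDir S u)ᗮ (eta d k ε) :=
      hS.angleLE_normal hSc hkd h.mem hy.1 (by linarith) hL (by
        rw [dist_comm]; exact (h.dist_nearest_center_le hy).trans hR)
    -- Both steps of the detour measure against `lfs S u`, so each costs `eta d k ε`; this one is
    -- reversed by `AngleLE.symm`.
    have huv : ∀ v ∈ S, dist u v = R →
        AngleLE (tangentDir S u)ᗮ (tangentDir S v)ᗮ (eta d k ε) := fun v hv hd => by
      refine (hS.angleLE_normal hSc hkd h.mem hv (by linarith) hL (hd.le.trans hR)).symm ?_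
      have h1 := hS.finrank_normal hv
      have h2 := hS.finrank_normal h.mem
      omega
    have key : ∀ w₀ w₁ w₂, w₀ ∈ S → w₁ ∈ S → w₂ ∈ S → dist u w₀ = R → dist u w₁ = R →
        dist u w₂ = R → ¬ Collinear ℝ {w₀, w₁, w₂} → (Real.pi - φ) / 2 ≤ ∠ w₁ w₀ w₂ →
        AngleLE (tangentDir S y)ᗮ (simplexNormal {w₀, w₁, w₂}).direction
          (2 * eta d k ε + Real.arcsin (ε / (1 - ε) * Real.cot (Real.pi / 4 - φ / 4))) := by
      intro w₀ w₁ w₂ hw₀ hw₁ hw₂ he₀ he₁ he₂ hc hang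
      have hcos' : Real.cos (∠ w₁ w₀ w₂) ≤ Real.cos ((Real.pi - φ) / 2) :=
        Real.cos_le_cos_of_nonneg_of_le_pi (by linarith) (angle_le_pi _ _) hang
      have h1 := hS.angleLE_simplexNormal hSc hk hkd hw₀ hw₁ hw₂ he₀ he₁ he₂ hc (hLv w₀ he₀)
        (hRv w₀ he₀) (by linarith) (by linarith) hcos'
      rw [show (Real.pi - φ) / 2 / 2 = Real.pi / 4 - φ / 4 by ring] at h1
      rw [two_mul]
      exact (hyu.trans (huv w₀ hw₀ he₀)).trans h1
    have hlt : ∠ v₁ v₀ v₂ < φ := by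
      by_contra! hge
      exact absurd (Real.cos_le_cos_of_nonneg_of_le_pi hφ0.le (angle_le_pi _ _) hge)
        (not_le.2 hcos)
    have hcol' : ¬ Collinear ℝ {v₁, v₀, v₂} := by rwa [Set.insert_comm]
    -- The other two angles sum to more than `π - φ`, so one of them is at least half of that.
    have hsum := angle_add_angle_add_angle_eq_pi v₂ (ne₁₂_of_not_collinear hcol')
    rcases le_or_gt ((Real.pi - φ) / 2) (∠ v₀ v₁ v₂) with h1 | h1
    · have := key v₁ v₀ v₂ hm₁ hm₀ hm₂ hd₁ hd₀ hd₂ hcol' h1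
      rwa [Finset.insert_comm] at this
    · have hcol'' : ¬ Collinear ℝ {v₂, v₀, v₁} := by
        rw [Set.insert_comm, Set.pair_comm]; exact hcol
      have := key v₂ v₀ v₁ hm₂ hm₀ hm₁ hd₂ hd₀ hd₁ hcol'' (by
        rw [EuclideanGeometry.angle_comm v₁ v₂ v₀, EuclideanGeometry.angle_comm v₂ v₀ v₁] at hsum
        linarith)
      rwa [Finset.insert_comm, Finset.pair_comm] at this

theorem IsSubmanifold.flatAngle_le_normalErrorBound (hS : IsSubmanifold k S) (hk : 2 ≤ k)
    {τ : Finset (EuclideanSpace ℝ (Fin d))} (hτ : τ.card = 3)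
    (hind : AffineIndependent ℝ (fun v : τ => (v : EuclideanSpace ℝ (Fin d))))
    {u x y : EuclideanSpace ℝ (Fin d)} {R ε φ : ℝ} (h : SmallSphere S τ u R x)
    (hε0 : 0 < ε) (hε : ε ≤ 1 / 3) (hR : R ≤ ε * lfs S u)
    (hy : IsNearestPoint S x y) (hφ0 : 0 < φ) (hφ : φ ≤ Real.pi / 3) :
    flatAngle (simplexNormal τ) (normalSpace S y) ≤ normalErrorBound d k ε φ := by
  classical
  have hfin := hS.finrank_normal hy.1
  have hbound := normalErrorBound_nonneg d k hε0.le (by linarith : ε ≤ 1) hφ0.le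
    (by linarith [Real.pi_pos])
  rcases (show k ≤ d by omega).eq_or_lt with hkd | hkd
  -- For `k = d` the normal space contains no line and the angle bound is vacuous.
  · have hbot : (tangentDir S y)ᗮ = ⊥ := Submodule.finrank_eq_zero.1 (by omega)
    refine flatAngle_le hbound ?_ ?_ <;> rw [normalSpace, AffineSubspace.direction_mk', hbot]
    · rw [finrank_bot]; exact Nat.zero_le _
    · exact fun v hv hv0 => absurd ((Submodule.mem_bot ℝ).1 hv) hv0
  obtain ⟨v, hv, hyv⟩ := h.exists_vertex_dist_le hy
  obtain ⟨v₀, v₁, v₂, rfl, hyv⟩ : ∃ v₀ v₁ v₂, τ = {v₀, v₁, v₂} ∧ dist y v₀ ≤ R := by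
    obtain ⟨a, b, c, -, -, -, rfl⟩ := Finset.card_eq_three.1 hτ
    simp only [Finset.coe_insert, Finset.coe_singleton, Set.mem_insert_iff,
      Set.mem_singleton_iff] at hv
    rcases hv with rfl | rfl | rfl
    · exact ⟨_, _, _, rfl, hyv⟩
    · exact ⟨v, a, c, Finset.insert_comm _ _ _, hyv⟩
    · exact ⟨v, a, b, by rw [Finset.insert_comm v, Finset.pair_comm v], hyv⟩
  have hangle := hS.angleLE_normalErrorBound hk hkd h (not_collinear_of_affineIndependent hτ hind)
    hε0 hε hR hy hyv hφ0 hφ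
  refine flatAngle_le hbound ?_ ?_ <;> rw [normalSpace, AffineSubspace.direction_mk']
  · rw [direction_simplexNormal (h.dist_eq v₀ (by simp)) (h.dist_eq v₁ (by simp))
      (h.dist_eq v₂ (by simp))]
    have h1 := (Submodule.span ℝ {v₁ - v₀, v₂ - v₀}).finrank_add_finrank_orthogonal
    have h2 := finrank_span_pair_le (v₁ - v₀) (v₂ - v₀)
    rw [finrank_euclideanSpace_fin] at h1
    omega
  · exact hangle

end Main

end SurfApprox

theorem corollary13 (d k : ℕ) (hk : 2 ≤ k) (S : Set (EuclideanSpace ℝ (Fin d)))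
    (hS : SurfApprox.IsSubmanifold k S) (hSc : IsCompact S)
    (ε : ℝ) (hε : ε < 1 / 2) (V : Finset (EuclideanSpace ℝ (Fin d)))
    (hV : SurfApprox.IsEpsSample S ε V)
    (τ : Finset (EuclideanSpace ℝ (Fin d)))
    (hτ : SurfApprox.IsRestrictedDelaunayTriangle S V τ)
    (x : EuclideanSpace ℝ (Fin d)) (hx : x ∈ convexHull ℝ (τ : Set (EuclideanSpace ℝ (Fin d)))) :
    (∃! y, SurfApprox.IsNearestPoint S x y) ∧
    ∀ y, SurfApprox.IsNearestPoint S x y →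
      dist x y ≤ (1 - √(1 - (ε / (1 - ε)) ^ 2)) * SurfApprox.lfs S y ∧
      (∀ u, SurfApprox.IsRestrictedVoronoiVertex S V τ u →
        dist x y ≤ (1 - ε - √(1 - 2 * ε)) * SurfApprox.lfs S u) ∧
      (ε ≤ 1 / 3 → ∀ φ ∈ Set.Ioc (0 : ℝ) (Real.pi / 3),
        SurfApprox.flatAngle (SurfApprox.simplexNormal τ) (SurfApprox.normalSpace S y) ≤
          SurfApprox.normalErrorBound d k ε φ) := by
  obtain ⟨hτV, hcard, hind, u₀, hu₀⟩ := hτ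
  have hsphere : ∀ u, SurfApprox.IsRestrictedVoronoiVertex S V τ u →
      0 < ε ∧ ∃ R, SurfApprox.SmallSphere S τ u R x ∧ R ≤ ε * SurfApprox.lfs S u := fun u hu =>
    hu.exists_smallSphere hSc hε hV hτV hcard hx
  obtain ⟨hε0, R₀, h₀, hR₀⟩ := hsphere u₀ hu₀
  refine ⟨h₀.existsUnique_isNearestPoint, fun y hy => ⟨?_, fun u hu => ?_, fun hε3 φ hφ => ?_⟩⟩
  · refine h₀.dist_nearest_le_lfs hy ?_ (SurfApprox.le_div_mul_lfs hε0.le (by linarith) hR₀ ?_)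
    · rw [div_lt_one (by linarith)]; linarith
    · rw [dist_comm]; exact h₀.dist_nearest_center_le hy
  · obtain ⟨-, R, h, hR⟩ := hsphere u hu
    have hL : 0 < SurfApprox.lfs S u := h.radius_pos.trans h.lt_lfs
    have hR2 : R ^ 2 ≤ (ε * SurfApprox.lfs S u) ^ 2 := pow_le_pow_left₀ h.radius_pos.le hR 2
    calc dist x y ≤ R ^ 2 / (2 * SurfApprox.lfs S u) := h.dist_nearest_le_sq hy
      _ ≤ (ε * SurfApprox.lfs S u) ^ 2 / (2 * SurfApprox.lfs S u) := by gcongr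
      _ = ε ^ 2 / 2 * SurfApprox.lfs S u := by field_simp
      _ ≤ _ := by gcongr; exact SurfApprox.sq_div_two_le hε0.le hε.le
  · exact hS.flatAngle_le_normalErrorBound hk hcard hind h₀ hε0 hε3 hR₀ hy hφ.1 hφ.2
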